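/- Let $G=(V,E)$ be a finite undirected (multi)graph with unit edge costs, let $(s_1,t_1),\dots,(s_r,t_r)$ be $r\ge 1$ source–sink pairs with $s_i\ne t_i$, and let $k\ge 2$ be an integer. Consider the linear program $$\text{(P)}\quad \min \sum_e x_e\ \text{ s.t. } \sum_{e\in P}(x_e+y^i_e)\ge 1\ \ \forall i,\ \forall\, s_i\text{-}t_i\text{ path }P;\quad \sum_e y^i_e\le k-1\ \ \forall i;\quad x,y\ge 0,$$ let $(x,\{y^i\})$ be an optimal solution and $\mathrm{OPT}=\sum_e x_e$ its value. Write $\Lambda(r)=\ln r\,\ln\ln r$ for $r\ge 3$ and $\Lambda(r)=1$ for $r\le 2$. *The algorithm $k$-MCAlg with parameter $\gamma>1$.* Subdivide every edge $e$ of $G$ into a path $e_0,e_1,\dots,e_r$; put the value $x_e$ on $e_0$ (an "$x$-edge") and $y^i_e$ on $e_i$, all other values being $0$. In the subdivided graph, for each $i$ let $\ell^i$ be the shortest-path metric for the edge lengths $x_f+y^i_f$. Let $\beta=\mathrm{OPT}/r$ and, for a node set $S$, let $E(S)$ be the set of edges with both ends in $S$, let $\mathcal V^x(S)=\beta+\sum_{f\in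 E(S)}x_f$, and for $A\subseteq S$ let $\delta^S(A)$ be the set of edges between $A$ and $S\setminus A$. For $\rho\ge 0$ let $B=B^S_i(\rho)=\{v\in S:\ell^i(s_i,v)\le\rho\}$; let $\mathcal V(\rho)=\beta+\sum_{uv}\ell^i(u,v)+\sum_{uw}(\rho-\ell^i(s_i,u))$ and $\overline{\mathcal V}(\rho)=\beta+\sum_{vw}\ell^i(v,w)+\sum_{uw}(\ell^i(s_i,w)-\rho)$, where all sums are over $x$-edges: $uv$ over those inside $B$, $vw$ (in $\overline{\mathcal V}$) over those inside $S\setminus B$, and $uw$ over those with $u\in B$, $w\in S\setminus B$. Call $\rho\in[0,1)$ *good* for $(S,i)$ if $$|\delta^S(B^S_i(\rho))|\le \tfrac{2\gamma}{(\sqrt\gamma-1)^2}\,W\ln\!\Big(\tfrac{e\,\mathcal V^x(S)}{W}\Big)\ln\ln(e(r+1))\quad\text{for both } W=\mathcal V(\rho)\text{ and }W=\overline{\mathcal V}(\rho).$$ A call $(U,\mathcal T)$ starts with $S=U$, $Z=\emptyset$. While some pair of $\mathcal T$ with both terminals in $S$ is at least $\gamma(k-1)$-edge-connected in $(S,E(S))$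 (i.e. has at least $\gamma(k-1)$ pairwise edge-disjoint paths there), pick any such pair $i$ and any good radius $\rho$ for $(S,i)$; let $A=B^S_i(\rho)$ if this set contains at most $|\mathcal T|/2$ pairs of $\mathcal T$, and $A=S\setminus B^S_i(\rho)$ otherwise; add $\delta^S(A)$ to $Z$ and replace $S$ by $S\setminus A$. Then, for each set $A$ so obtained, call the algorithm recursively on $A$ and the pairs of $\mathcal T$ contained in $A$, add the results to $Z$, and return $Z$. The initial call is on all nodes of the subdivided graph and all $r$ pairs, and the output is the set of edges of $G$ that have a part in the returned set. **Theorem.** There is an absolute constant $C>0$ such that the following holds for all such instances and optimal solutions. 1. For every $\gamma>1$, the algorithm is well defined (a good radius exists for every $S$ and every pair $i$ with both terminals in $S$ that is at least $\gamma(k-1)$-edge-connected in $(S,E(S))$) and, however its choices are made, it terminates; every edge set $Z$ that it returns is such that every pair $s_i,t_i$ is less than $\gamma(k-1)$-edge-connected in $(V,E\setminus Z)$, and $$|Z|\le C\,\frac{\gamma}{(\sqrt\gamma-1)^2}\,\Lambda(r)\cdot \mathrm{OPT}.$$ 2. In particular, for $\gamma=\frac{k}{k-1}$ every returned set $Z$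 is a feasible solution of $k$-route multicut (for each $i$ there are at most $k-1$ edge-disjoint $s_i$-$t_i$ paths in $(V,E\setminus Z)$) and $|Z|\le C\,(k-1)^2\,\Lambda(r)\cdot\mathrm{OPT}$. -/

import Mathlib

open scoped ENNReal

noncomputable section

/-- An undirected multigraph with vertex type `V` and edge type `E`. The edge `e`
joins `left e` and `right e`; which end is called left is immaterial. -/
structure MultiGraph (V E : Type*) where
  left : E → V
  right : E → V

namespace MultiGraph

variable {V E : Type*} (G : MultiGraph V E)

/-- `e` is an edge between `u` and `v` (in either order). -/
def Joins (e : E) (u v : V) : Prop :=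
  (G.left e = u ∧ G.right e = v) ∨ (G.left e = v ∧ G.right e = u)

inductive Walk : V → V → Type _
  | nil (u : V) : Walk u u
  | cons {u v w : V} (e : E) (h : G.Joins e u v) (p : Walk v w) : Walk u w

namespace Walk

variable {G}

def edges : {u v : V} → G.Walk u v → List E
  | _, _, nil _ => []
  | _, _, cons e _ p => e :: p.edges

def support : {u v : V} → G.Walk u v → List V
  | _, _, nil u => [u]
  | u, _, cons _ _ p => u :: p.support

/-- A simple path: no vertex is repeated. -/
def IsPath {u v : V} (p : G.Walk u v) : Prop := p.support.Nodup

/-- Total length of a walk for the edge lengths `l`. -/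
def length {u v : V} (l : E → ℝ) (p : G.Walk u v) : ℝ := (p.edges.map l).sum

end Walk

/-- There are `m` pairwise edge-disjoint `u`-`v` paths all of whose edges lie in `F`. -/
def HasDisjointPaths (F : Set E) (u v : V) (m : ℕ) : Prop :=
  ∃ P : Fin m → G.Walk u v,
    (∀ j, (P j).IsPath ∧ ∀ e ∈ (P j).edges, e ∈ F) ∧
    ∀ j j', j ≠ j' → List.Disjoint (P j).edges (P j').edges

/-- `u` and `v` are at least `q`-edge-connected (`q` real) in the graph with edge set `F`. -/
def AtLeastConnected (F : Set E) (u v : V) (q : ℝ) : Prop :=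
  ∃ m : ℕ, q ≤ m ∧ G.HasDisjointPaths F u v m

/-- The shortest-path metric for edge lengths `l ≥ 0`; it is `∞` between different components. -/
def pathDist (l : E → ℝ) (u v : V) : ℝ≥0∞ :=
  ⨅ p : G.Walk u v, ENNReal.ofReal (p.length l)

/-- `E(S)`: the edges with both ends in `S`. -/
def inside (S : Finset V) : Set E := {e | G.left e ∈ S ∧ G.right e ∈ S}

open scoped Classical in
/-- `δ^S(A)`: the edges with one end in `A` and the other in `S \ A`. -/
def boundary [Fintype E] (S A : Finset V) : Finset E :=
  Finset.univ.filter fun e => ∃ u ∈ A, ∃ v ∈ S \ A, G.Joins e u v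

open scoped Classical in
/-- `B^S_ℓ(z, ρ)`. -/
def ball (l : V → V → ℝ≥0∞) (S : Finset V) (z : V) (ρ : ℝ) : Finset V :=
  S.filter fun v => l z v ≤ ENNReal.ofReal ρ

open scoped Classical in
/-- `𝒱^{S,F}_ℓ(β; z, ρ)` for unit costs: the second and third sums run over the edges of `F` from
the ball to its complement in `S`, according to which end is in the ball. -/
def volume (l : V → V → ℝ≥0∞) (F : Finset E) (S : Finset V) (β : ℝ) (z : V) (ρ : ℝ) : ℝ :=
  let B := ball l S z ρ
  β + ∑ e ∈ F with G.left e ∈ B ∧ G.right e ∈ B, (l (G.left e) (G.right e)).toReal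
    + ∑ e ∈ F with G.left e ∈ B ∧ G.right e ∈ S \ B, (ρ - (l z (G.left e)).toReal)
    + ∑ e ∈ F with G.right e ∈ B ∧ G.left e ∈ S \ B, (ρ - (l z (G.right e)).toReal)

open scoped Classical in
/-- The complementary volume, of the part of `S` outside the ball, for unit costs. -/
def coVolume (l : V → V → ℝ≥0∞) (F : Finset E) (S : Finset V) (β : ℝ) (z : V) (ρ : ℝ) : ℝ :=
  let B := ball l S z ρ
  β + ∑ e ∈ F with G.left e ∈ S \ B ∧ G.right e ∈ S \ B, (l (G.left e) (G.right e)).toReal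
    + ∑ e ∈ F with G.left e ∈ B ∧ G.right e ∈ S \ B, ((l z (G.right e)).toReal - ρ)
    + ∑ e ∈ F with G.right e ∈ B ∧ G.left e ∈ S \ B, ((l z (G.left e)).toReal - ρ)

/-- The `m`-th node (`0 ≤ m ≤ r + 1`) on the path that replaces `e` when every edge is subdivided
into `r + 1` edges. -/
def subNode (r : ℕ) (e : E) (m : ℕ) : V ⊕ (E × Fin r) :=
  if m = 0 then Sum.inl (G.left e)
  else if h : m - 1 < r then Sum.inr (e, ⟨m - 1, h⟩)
  else Sum.inl (G.right e)

/-- Every edge `e` is subdivided into the path `(e,0), (e,1), …, (e,r)`. -/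
def subdivide (r : ℕ) : MultiGraph (V ⊕ (E × Fin r)) (E × Fin (r + 1)) where
  left f := G.subNode r f.1 (f.2 : ℕ)
  right f := G.subNode r f.1 ((f.2 : ℕ) + 1)

end MultiGraph

/-- A unit-cost multicut instance with `r` source-sink pairs. -/
structure MulticutInstance (V E : Type*) (r : ℕ) where
  graph : MultiGraph V E
  s : Fin r → V
  t : Fin r → V
  ne : ∀ i, s i ≠ t i

namespace MulticutInstance

variable {V E : Type*} {r : ℕ} (I : MulticutInstance V E r)

/-- Feasibility for `k`-route multicut: after removing `Z`, any family of edge-disjoint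
`s i`-`t i` paths has at most `k - 1` members. -/
def IsFeasible (k : ℕ) (Z : Finset E) : Prop :=
  ∀ i m, I.graph.HasDisjointPaths {e | e ∉ Z} (I.s i) (I.t i) m → m < k

/-- `(x, y)` is a feasible point of the linear relaxation of `k`-route multicut. -/
def LPFeasible [Fintype E] (k : ℕ) (x : E → ℝ) (y : Fin r → E → ℝ) : Prop :=
  (∀ i (P : I.graph.Walk (I.s i) (I.t i)), P.IsPath → 1 ≤ P.length fun e => x e + y i e) ∧
  (∀ i, ∑ e, y i e ≤ (k : ℝ) - 1) ∧
  (∀ e, 0 ≤ x e) ∧ ∀ i e, 0 ≤ y i e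

/-- `(x, y)` is an optimal solution of the linear relaxation with unit costs. -/
def LPOptimal [Fintype E] (k : ℕ) (x : E → ℝ) (y : Fin r → E → ℝ) : Prop :=
  I.LPFeasible k x y ∧ ∀ x' y', I.LPFeasible k x' y' → ∑ e, x e ≤ ∑ e, x' e

end MulticutInstance

/-- The data on which the rounding algorithm works: a graph with source-sink pairs, a fractional
solution `(x, y)`, and the set `F` of `x`-edges. -/
structure RoundingData (V E : Type*) (r : ℕ) where
  graph : MultiGraph V E
  s : Fin r → V
  t : Fin r → V
  x : E → ℝ
  y : Fin r → E → ℝ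
  F : Finset E

open scoped Classical in
/-- The subdivided graph: `(e,0)` is an `x`-edge and carries `x e`, and `(e,i+1)` is a `y i`-edge
and carries `y i e`. -/
def MulticutInstance.subdivide {V E : Type*} [Fintype E] {r : ℕ} (I : MulticutInstance V E r)
    (x : E → ℝ) (y : Fin r → E → ℝ) :
    RoundingData (V ⊕ (E × Fin r)) (E × Fin (r + 1)) r where
  graph := I.graph.subdivide r
  s i := Sum.inl (I.s i)
  t i := Sum.inl (I.t i)
  x f := if f.2 = 0 then x f.1 else 0
  y i f := if f.2 = i.succ then y i f.1 else 0
  F := Finset.univ.filter fun f => f.2 = 0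

namespace RoundingData

variable {V E : Type*} [Fintype E] {r : ℕ} (D : RoundingData V E r)

/-- The value of the fractional solution. -/
def opt : ℝ := ∑ e, D.x e

def β : ℝ := D.opt / r

/-- The metric `ℓ^i` of commodity `i`. -/
def dist (i : Fin r) : V → V → ℝ≥0∞ := D.graph.pathDist fun e => D.x e + D.y i e

open scoped Classical in
/-- `𝒱^x(S)`. -/
def xVolume (S : Finset V) : ℝ := D.β + ∑ e with e ∈ D.graph.inside S, D.x e

/-- `B^S_i(s_i, ρ)`. -/
def ball (S : Finset V) (i : Fin r) (ρ : ℝ) : Finset V :=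
  MultiGraph.ball (D.dist i) S (D.s i) ρ

/-- The radii `ρ ∈ [0,1)` that may be used for commodity `i` and the current node set `S`: the cost
of the boundary of the ball is bounded through the volumes on both sides. -/
def GoodRadius (γ : ℝ) (S : Finset V) (i : Fin r) (ρ : ℝ) : Prop :=
  let cut : ℝ := (D.graph.boundary S (D.ball S i ρ)).card
  let vol := D.graph.volume (D.dist i) D.F S D.β (D.s i) ρ
  let covol := D.graph.coVolume (D.dist i) D.F S D.β (D.s i) ρ
  let K := 2 * γ / (√γ - 1) ^ 2
  let L := Real.log (Real.log (Real.exp 1 * (r + 1)))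
  0 ≤ ρ ∧ ρ < 1 ∧
  cut ≤ K * vol * Real.log (Real.exp 1 * D.xVolume S / vol) * L ∧
  cut ≤ K * covol * Real.log (Real.exp 1 * D.xVolume S / covol) * L

open scoped Classical in
/-- The pairs of `T` with both terminals in `X`. -/
def pairsIn (T : Finset (Fin r)) (X : Finset V) : Finset (Fin r) :=
  T.filter fun i => D.s i ∈ X ∧ D.t i ∈ X

open scoped Classical in
/-- `𝒯'`: the pairs of `T` that are at least `γ(k-1)`-edge-connected in `(S, E(S))`. -/
def active (γ : ℝ) (k : ℕ) (T : Finset (Fin r)) (S : Finset V) : Finset (Fin r) :=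
  (D.pairsIn T S).filter fun i =>
    D.graph.AtLeastConnected (D.graph.inside S) (D.s i) (D.t i) (γ * ((k : ℝ) - 1))

open scoped Classical in
/-- The region carved out of `S`: the ball if it contains at most half of the pairs of `T`, and
otherwise its complement in `S`. -/
def region (T : Finset (Fin r)) (S : Finset V) (i : Fin r) (ρ : ℝ) : Finset V :=
  if 2 * (D.pairsIn T (D.ball S i ρ)).card ≤ T.card then D.ball S i ρ else S \ D.ball S i ρ

end RoundingData

/-- A resolution of the two choices that the algorithm leaves open: which active pair is processed
next when the pairs of the call are `T` and the current node set is `S`, and which radius is used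
for the pair `i` and the set `S`. (No set `S` with an active pair occurs twice in an execution, so
every execution comes from such a resolution.) -/
structure Choices (V : Type*) (r : ℕ) where
  pick : Finset (Fin r) → Finset V → Fin r
  radius : Finset V → Fin r → ℝ

namespace RoundingData

variable {V E : Type*} [Fintype E] {r : ℕ} (D : RoundingData V E r)

/-- The choices respect the rules of the algorithm: the pair picked is active, and the radius used
for an active pair is a good one. -/
def ValidChoices (γ : ℝ) (k : ℕ) (χ : Choices V r) : Prop :=
  (∀ T S, (D.active γ k T S).Nonempty → χ.pick T S ∈ D.active γ k T S) ∧
  ∀ S, ∀ i ∈ D.active γ k Finset.univ S, D.GoodRadius γ S i (χ.radius S i)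

/-- The region carved out of the current set `S` in a call with pairs `T`. -/
def nextRegion (χ : Choices V r) (T : Finset (Fin r)) (S : Finset V) : Finset V :=
  D.region T S (χ.pick T S) (χ.radius S (χ.pick T S))

open scoped Classical in
/-- The while loop of a call with pairs `T`: `D.Carve γ k χ T S 𝒮 Z` says that, started from the
current node set `S`, the loop ends, having carved out the regions `𝒮` (in this order) and having
collected the set `Z` of all their boundary edges. -/
inductive Carve (γ : ℝ) (k : ℕ) (χ : Choices V r) (T : Finset (Fin r)) :
    Finset V → List (Finset V) → Finset E → Prop
  | done (S : Finset V) (h : D.active γ k T S = ∅) : Carve γ k χ T S [] ∅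
  | step (S : Finset V) (𝒮 : List (Finset V)) (Z : Finset E)
      (h : (D.active γ k T S).Nonempty)
      (next : Carve γ k χ T (S \ D.nextRegion χ T S) 𝒮 Z) :
      Carve γ k χ T S (D.nextRegion χ T S :: 𝒮) (D.graph.boundary S (D.nextRegion χ T S) ∪ Z)

open scoped Classical in
/-- `D.Returns γ k χ U T Z`: the recursive call with node set `U` and pairs `T` terminates and
returns `Z`. After the while loop every carved region `A` is treated recursively, with the pairs
inside `A`, and `R A` is what this recursive call returns. -/
inductive Returns (γ : ℝ) (k : ℕ) (χ : Choices V r) :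
    Finset V → Finset (Fin r) → Finset E → Prop
  | call (U : Finset V) (T : Finset (Fin r)) (𝒮 : List (Finset V)) (Z : Finset E)
      (R : Finset V → Finset E)
      (loop : D.Carve γ k χ T U 𝒮 Z)
      (recurse : ∀ A ∈ 𝒮, Returns γ k χ A (D.pairsIn T A) (R A)) :
      Returns γ k χ U T (Z ∪ 𝒮.toFinset.biUnion R)

end RoundingData

open scoped Classical in
/-- The algorithm `k`-MCAlg with parameter `γ`, run on the fractional solution `(x, y)` with choices
`χ`, returns the edge set `Z` of the given graph: it is called on the whole subdivided graph and all
pairs, and `Z` consists of the edges one of whose parts is in the set that this call returns. -/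
def MulticutInstance.AlgReturns {V E : Type*} [Fintype V] [Fintype E] {r : ℕ}
    (I : MulticutInstance V E r) (k : ℕ) (γ : ℝ) (x : E → ℝ) (y : Fin r → E → ℝ)
    (χ : Choices (V ⊕ (E × Fin r)) r) (Z : Finset E) : Prop :=
  ∃ Z', (I.subdivide x y).Returns γ k χ Finset.univ Finset.univ Z' ∧ Z = Z'.image Prod.fst

/-- `ln r · ln ln r`, replaced by `1` for `r ≤ 2`, where `ln ln r` is undefined or negative. -/
def logFactor (r : ℕ) : ℝ := if r ≤ 2 then 1 else Real.log r * Real.log (Real.log r)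

end

/-!
A pair that is `γ (k - 1)`-edge-connected in the current region forces every ball of radius
`ρ ∈ [0, 1)` around its source to cut at least `γ (k - 1)` edges, while the budget on `y` leaves at
most `k - 1` of them, on average over `ρ`, to `y`-edges; so a fixed fraction of the cut consists of
`x`-edges. Wherever the radius is not good for a volume `V`, the potential `-ln ln (e X / V)`, where
`X` is the volume of the region, thus grows quickly. Both potentials, for the volume inside and for
the volume outside the ball, vary by at most `ln ln (e (r + 1))` in total, and the factor in the
definition of a good radius is just large enough that the bad radii cannot fill `[0, 1)`.

For the cost, let a call with `N` pairs have reached the region `S`, with `n` of the pairs inside.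
The potential `w(S) (log₂ (2 N) + ln (𝒱ˣ(S) / β)) + β n ln (e (r + 1))`, with `w` the `x`-weight,
pays for each cut, of cost `W ln (e 𝒱ˣ(S) / W)`: the part carved off is charged for its own volume
only, contains at most half of the `N` pairs, and splits at least one pair.
-/

/-! ### Walks, distances and cuts -/

namespace MultiGraph

variable {V E : Type*} {G : MultiGraph V E}

theorem Joins.symm {e : E} {u v : V} (h : G.Joins e u v) : G.Joins e v u := Or.symm h

theorem joins_left_right (G : MultiGraph V E) (e : E) : G.Joins e (G.left e) (G.right e) :=
  Or.inl ⟨rfl, rfl⟩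

theorem Joins.mem_inside_iff {e : E} {u v : V} (h : G.Joins e u v) {S : Finset V} :
    e ∈ G.inside S ↔ u ∈ S ∧ v ∈ S := by
  rcases h with ⟨rfl, rfl⟩ | ⟨rfl, rfl⟩
  exacts [Iff.rfl, and_comm]

namespace Walk

@[simp]
theorem length_nil (l : E → ℝ) (u : V) : (nil (G := G) u).length l = 0 := by
  simp [length, edges]

@[simp]
theorem length_cons {u v w : V} (l : E → ℝ) (e : E) (h : G.Joins e u v) (p : G.Walk v w) :
    (cons e h p).length l = l e + p.length l := by
  simp [length, edges]

theorem length_nonneg {l : E → ℝ} (hl : ∀ e, 0 ≤ l e) {u v : V} (p : G.Walk u v) :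
    0 ≤ p.length l :=
  List.sum_nonneg (by simpa using fun e _ => hl e)

theorem exists_suffix {u v w : V} (p : G.Walk u w) (hv : v ∈ p.support) :
    ∃ q : G.Walk v w, q.edges.Sublist p.edges ∧ q.support.Sublist p.support := by
  induction p with
  | nil u =>
    obtain rfl : v = u := by simpa only [support, List.mem_singleton] using hv
    exact ⟨nil v, List.Sublist.refl _, List.Sublist.refl _⟩
  | cons e h p ih =>
    rcases List.mem_cons.1 hv with rfl | hv
    · exact ⟨cons e h p, List.Sublist.refl _, List.Sublist.refl _⟩
    · obtain ⟨q, hedges, hsupport⟩ := ih hv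
      exact ⟨q, hedges.cons _, hsupport.cons _⟩

theorem exists_isPath {u v : V} (p : G.Walk u v) :
    ∃ q : G.Walk u v, q.IsPath ∧ q.edges.Sublist p.edges := by
  induction p with
  | nil u => exact ⟨nil u, List.nodup_singleton u, List.Sublist.refl _⟩
  | @cons u _ _ e h p ih =>
    obtain ⟨q, hq, hsub⟩ := ih
    by_cases hu : u ∈ q.support
    · obtain ⟨q', hedges, hsupport⟩ := q.exists_suffix hu
      exact ⟨q', hsupport.nodup hq, (hedges.trans hsub).cons _⟩
    · exact ⟨cons e h q, List.nodup_cons.2 ⟨hu, hq⟩, hsub.cons_cons e⟩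

theorem exists_leaving_edge {X : Set V} {u v : V} (p : G.Walk u v) (hu : u ∈ X) (hv : v ∉ X) :
    ∃ e ∈ p.edges, ∃ a ∈ X, ∃ b ∉ X, G.Joins e a b := by
  induction p with
  | nil u => exact absurd hu hv
  | @cons a b _ e h p ih =>
    by_cases hb : b ∈ X
    · obtain ⟨f, hf, hleaves⟩ := ih hb hv
      exact ⟨f, List.mem_cons_of_mem _ hf, hleaves⟩
    · exact ⟨e, List.mem_cons_self, a, hu, b, hb, h⟩

theorem mem_and_edges_inside_of_closed {X : Finset V} {u v : V} (p : G.Walk u v) (hu : u ∈ X)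
    (hX : ∀ e ∈ p.edges, ∀ a ∈ X, ∀ b, G.Joins e a b → b ∈ X) :
    v ∈ X ∧ ∀ e ∈ p.edges, e ∈ G.inside X := by
  induction p with
  | nil u => exact ⟨hu, by simp [edges]⟩
  | @cons a b _ e h p ih =>
    have hb : b ∈ X := hX e List.mem_cons_self a hu b h
    obtain ⟨hv, hinside⟩ := ih hb fun f hf => hX f (List.mem_cons_of_mem _ hf)
    exact ⟨hv, List.forall_mem_cons.2 ⟨h.mem_inside_iff.2 ⟨hu, hb⟩, hinside⟩⟩

theorem le_add_length {l : E → ℝ} (hl : ∀ e, 0 ≤ l e) {f : V → ℝ≥0∞}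
    (hf : ∀ e a b, G.Joins e a b → f b ≤ f a + ENNReal.ofReal (l e)) {u v : V}
    (p : G.Walk u v) : f v ≤ f u + ENNReal.ofReal (p.length l) := by
  induction p with
  | nil u => simp
  | @cons u b v e h p ih =>
    calc f v ≤ f b + ENNReal.ofReal (p.length l) := ih
      _ ≤ f u + ENNReal.ofReal (l e) + ENNReal.ofReal (p.length l) := by gcongr; exact hf e u b h
      _ = f u + ENNReal.ofReal ((cons e h p).length l) := by
        rw [length_cons, ENNReal.ofReal_add (hl e) (p.length_nonneg hl), add_assoc]

end Walk

section PathDist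

variable {l : E → ℝ}

@[simp]
theorem pathDist_self (l : E → ℝ) (u : V) : G.pathDist l u u = 0 :=
  le_antisymm (iInf_le_of_le (.nil u) (by simp)) bot_le

theorem pathDist_le_of_joins (l : E → ℝ) {e : E} {u v : V} (h : G.Joins e u v) :
    G.pathDist l u v ≤ ENNReal.ofReal (l e) :=
  iInf_le_of_le (.cons e h (.nil v)) (by simp)

theorem Joins.pathDist_le_add {e : E} {a b : V} (h : G.Joins e a b) (l : E → ℝ) (v : V) :
    G.pathDist l a v ≤ ENNReal.ofReal (l e) + G.pathDist l b v := by
  rw [pathDist, pathDist, ENNReal.add_iInf]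
  refine le_iInf fun p => iInf_le_of_le (.cons e h p) ?_
  rw [Walk.length_cons]
  exact ENNReal.ofReal_add_le

theorem le_add_pathDist (hl : ∀ e, 0 ≤ l e) {f : V → ℝ≥0∞}
    (hf : ∀ e a b, G.Joins e a b → f b ≤ f a + ENNReal.ofReal (l e)) (u v : V) :
    f v ≤ f u + G.pathDist l u v := by
  rw [pathDist, ENNReal.add_iInf]
  exact le_iInf fun p => p.le_add_length hl hf

theorem pathDist_comm (hl : ∀ e, 0 ≤ l e) (u v : V) : G.pathDist l u v = G.pathDist l v u := by
  have hle (u v : V) : G.pathDist l v u ≤ G.pathDist l u v := by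
    simpa using le_add_pathDist hl (f := fun w => G.pathDist l w u)
      (fun e a b h => (h.symm.pathDist_le_add l u).trans_eq (add_comm _ _)) u v
  exact le_antisymm (hle v u) (hle u v)

theorem pathDist_triangle (hl : ∀ e, 0 ≤ l e) (u v w : V) :
    G.pathDist l u w ≤ G.pathDist l u v + G.pathDist l v w := by
  refine le_add_pathDist hl (f := G.pathDist l u) (fun e a b h => ?_) v w
  rw [pathDist_comm hl u b, pathDist_comm hl u a, add_comm]
  exact h.symm.pathDist_le_add l u

theorem le_pathDist (hl : ∀ e, 0 ≤ l e) {c : ℝ≥0∞} {u v : V}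
    (h : ∀ p : G.Walk u v, p.IsPath → c ≤ ENNReal.ofReal (p.length l)) : c ≤ G.pathDist l u v := by
  refine le_iInf fun p => ?_
  obtain ⟨q, hq, hsub⟩ := p.exists_isPath
  refine (h q hq).trans (ENNReal.ofReal_le_ofReal ((hsub.map l).sum_le_sum ?_))
  simpa using fun e _ => hl e

end PathDist

section Boundary

theorem HasDisjointPaths.inside_of_closed {F Q : Set E} {X : Finset V} {u v : V} {m : ℕ}
    (h : G.HasDisjointPaths (F ∩ Q) u v m) (hu : u ∈ X) (hm : 0 < m)
    (hX : ∀ e ∈ F ∩ Q, ∀ a ∈ X, ∀ b, G.Joins e a b → b ∈ X) :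
    v ∈ X ∧ G.HasDisjointPaths (G.inside X ∩ Q) u v m := by
  obtain ⟨P, hP, hdisj⟩ := h
  have hstays (j : Fin m) :=
    (P j).mem_and_edges_inside_of_closed hu fun e he => hX e ((hP j).2 e he)
  exact ⟨(hstays ⟨0, hm⟩).1, P,
    fun j => ⟨(hP j).1, fun e he => ⟨(hstays j).2 e he, ((hP j).2 e he).2⟩⟩, hdisj⟩

variable [Fintype E] {S A : Finset V} {e : E}

theorem mem_boundary : e ∈ G.boundary S A ↔ ∃ u ∈ A, ∃ v ∈ S, v ∉ A ∧ G.Joins e u v := by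
  simp only [boundary, Finset.mem_filter_univ, Finset.mem_sdiff, and_assoc]

theorem boundary_sdiff [DecidableEq V] (hA : A ⊆ S) : G.boundary S (S \ A) = G.boundary S A := by
  ext e
  simp only [mem_boundary, Finset.mem_sdiff]
  constructor
  · rintro ⟨u, ⟨hu, hu'⟩, v, hv, hv', h⟩
    exact ⟨v, by tauto, u, hu, hu', h.symm⟩
  · rintro ⟨u, hu, v, hv, hv', h⟩
    exact ⟨v, ⟨hv, hv'⟩, u, hA hu, by tauto, h.symm⟩

theorem HasDisjointPaths.le_card_boundary {u v : V} {m : ℕ}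
    (h : G.HasDisjointPaths (G.inside S) u v m) (hu : u ∈ A) (hv : v ∉ A) :
    m ≤ (G.boundary S A).card := by
  obtain ⟨P, hP, hdisj⟩ := h
  have hcrosses (j : Fin m) : ∃ e ∈ (P j).edges, e ∈ G.boundary S A := by
    obtain ⟨e, he, a, ha, b, hb, hjoins⟩ :=
      (P j).exists_leaving_edge (X := {w | w ∈ A}) hu hv
    have hbS : b ∈ S := (hjoins.mem_inside_iff.1 ((hP j).2 e he)).2
    exact ⟨e, he, mem_boundary.2 ⟨a, ha, b, hbS, hb, hjoins⟩⟩
  choose c hc hcut using hcrosses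
  have hinj : Function.Injective c := fun j j' hjj' => by
    by_contra hne
    exact hdisj j j' hne (hc j) (hjj' ▸ hc j')
  simpa using Finset.card_le_card_of_injOn c (s := Finset.univ) (fun j _ => hcut j) hinj.injOn

end Boundary

end MultiGraph

/-! ### Averaging over the radius -/

section Averaging

open MeasureTheory Set

theorem exists_deriv_mul_sub_le_of_monotoneOn {f : ℝ → ℝ} {a b : ℝ} (hab : a < b)
    (hf : MonotoneOn f (Icc a b)) {p : ℝ → Prop} (hp : ∀ᵐ x, x ∈ Ioo a b → p x) :
    ∃ x ∈ Ioo a b, p x ∧ deriv f x * (b - a) ≤ f b - f a := by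
  have hba : 0 < b - a := sub_pos.2 hab
  rw [← uIcc_of_le hab.le] at hf
  have hint : IntegrableOn (deriv f) (Ioo a b) :=
    (intervalIntegrable_iff_integrableOn_Ioo_of_le hab.le).1 hf.intervalIntegrable_deriv
  have hp' : ∀ᵐ x ∂volume.restrict (Ioo a b), x ∈ Ioo a b ∧ p x :=
    (ae_restrict_iff' measurableSet_Ioo).2 (hp.mono fun x hx hab => ⟨hab, hx hab⟩)
  obtain ⟨x, hx, hle⟩ := exists_notMem_null_le_average
    (by simpa only [ne_eq, Measure.restrict_eq_zero, Real.volume_Ioo, ENNReal.ofReal_eq_zero,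
      not_le] using hba) hint (ae_iff.1 hp')
  have hintegral : ∫ x in Ioo a b, deriv f x ≤ f b - f a := by
    have hmem := hf.intervalIntegral_deriv_mem_uIcc
    rw [intervalIntegral.integral_of_le hab.le, integral_Ioc_eq_integral_Ioo,
      uIcc_of_le (sub_nonneg.2 (hf left_mem_uIcc right_mem_uIcc hab.le))] at hmem
    exact hmem.2
  rw [setAverage_eq, smul_eq_mul, Real.volume_real_Ioo_of_le hab.le, inv_mul_eq_div,
    le_div_iff₀ hba] at hle
  obtain ⟨hx, hpx⟩ := not_not.1 hx
  exact ⟨x, hx, hpx, hle.trans hintegral⟩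

/-- `f` is nondecreasing on `[0,1]`, has the derivative `f'` at almost every point of `(0,1)`, and
grows by at most `M`. This packages a function of the radius that is to be averaged; it may jump. -/
structure HasGrowth (f f' : ℝ → ℝ) (M : ℝ) : Prop where
  monotoneOn : MonotoneOn f (Icc 0 1)
  hasDerivAt : ∀ᵐ ρ, ρ ∈ Ioo 0 1 → HasDerivAt f (f' ρ) ρ
  sub_le : f 1 - f 0 ≤ M

theorem HasGrowth.exists_mem_Ioo_forall_le {ι : Type*} [Fintype ι] {f f' : ι → ℝ → ℝ}
    {M c : ι → ℝ} (h : ∀ j, HasGrowth (f j) (f' j) (M j)) (hc : ∀ j, 0 < c j)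
    (hM : ∑ j, M j / c j ≤ 1) : ∃ ρ ∈ Ioo (0 : ℝ) 1, ∀ j, f' j ρ ≤ c j := by
  have hmono : MonotoneOn (fun ρ => ∑ j, f j ρ / c j) (Icc 0 1) := fun ρ hρ ρ' hρ' hle =>
    Finset.sum_le_sum fun j _ =>
      div_le_div_of_nonneg_right ((h j).monotoneOn hρ hρ' hle) (hc j).le
  obtain ⟨ρ, hρ, hderiv, hle⟩ := exists_deriv_mul_sub_le_of_monotoneOn zero_lt_one hmono
    (p := fun ρ => ∀ j, HasDerivAt (f j) (f' j ρ) ρ) (by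
      filter_upwards [ae_all_iff.2 fun j => (h j).hasDerivAt] with ρ hρ hmem j using hρ j hmem)
  have hsum : ∑ j, f' j ρ / c j ≤ 1 :=
    calc ∑ j, f' j ρ / c j
        = deriv (fun ρ => ∑ j, f j ρ / c j) ρ * (1 - 0) := by
          rw [(HasDerivAt.fun_sum fun j _ => (hderiv j).div_const (c j)).deriv, sub_zero, mul_one]
      _ ≤ ∑ j, f j 1 / c j - ∑ j, f j 0 / c j := hle
      _ = ∑ j, (f j 1 - f j 0) / c j := by simp only [sub_div, Finset.sum_sub_distrib]
      _ ≤ ∑ j, M j / c j :=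
          Finset.sum_le_sum fun j _ => div_le_div_of_nonneg_right (h j).sub_le (hc j).le
      _ ≤ 1 := hM
  have hnonneg (j : ι) : 0 ≤ f' j ρ / c j := by
    refine div_nonneg ?_ (hc j).le
    refine (hderiv j).hasDerivWithinAt.nonneg_of_monotoneOn ?_
      ((h j).monotoneOn.mono Ioo_subset_Icc_self)
    exact ((uniqueDiffOn_Ioo 0 1) ρ hρ).accPt
  exact ⟨ρ, hρ, fun j => (div_le_one (hc j)).1
    ((Finset.single_le_sum (fun j _ => hnonneg j) (Finset.mem_univ j)).trans hsum)⟩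

end Averaging

section LogLog

open Real

variable {X c u v β : ℝ}

theorem one_le_log_exp_mul_div (hu : 0 < u) (huX : u ≤ X) : 1 ≤ log (exp 1 * X / u) := by
  have hX : 0 < X := hu.trans_le huX
  rw [le_log_iff_exp_le (by positivity), le_div_iff₀ hu]
  gcongr

theorem mul_log_exp_mul_div_pos (hu : 0 < u) (huX : u ≤ X) : 0 < u * log (exp 1 * X / u) :=
  mul_pos hu (zero_lt_one.trans_le (one_le_log_exp_mul_div hu huX))

theorem log_log_exp_mul_div_nonneg (hu : 0 < u) (huX : u ≤ X) :
    0 ≤ log (log (exp 1 * X / u)) :=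
  log_nonneg (one_le_log_exp_mul_div hu huX)

theorem log_log_exp_mul_div_anti (hu : 0 < u) (huv : u ≤ v) (hvX : v ≤ X) :
    log (log (exp 1 * X / v)) ≤ log (log (exp 1 * X / u)) := by
  have hv : 0 < v := hu.trans_le huv
  have hX : 0 < X := hv.trans_le hvX
  refine log_le_log (zero_lt_one.trans_le (one_le_log_exp_mul_div hv hvX))
    (log_le_log (by positivity) ?_)
  gcongr

theorem log_log_exp_mul_div_le (hβ : 0 < β) (hu : β ≤ u) (huX : u ≤ X) (hX : X ≤ c * β) :
    log (log (exp 1 * X / u)) ≤ log (log (exp 1 * c)) := by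
  have hβX : β ≤ X := hu.trans huX
  refine (log_log_exp_mul_div_anti hβ hu huX).trans
    (log_le_log (zero_lt_one.trans_le (one_le_log_exp_mul_div hβ hβX))
      (log_le_log (have := hβ.trans_le hβX; by positivity) ?_))
  rw [div_le_iff₀ hβ, mul_assoc]
  gcongr

theorem hasDerivAt_log_log_exp_mul_div {f : ℝ → ℝ} {f' ρ : ℝ} (hf : HasDerivAt f f' ρ)
    (h0 : 0 < f ρ) (hX : f ρ ≤ X) :
    HasDerivAt (fun t => log (log (exp 1 * X / f t)))
      (-(f' / (f ρ * log (exp 1 * X / f ρ)))) ρ := by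
  have hX0 : 0 < X := h0.trans_le hX
  have hlog : log (exp 1 * X / f ρ) ≠ 0 :=
    (zero_lt_one.trans_le (one_le_log_exp_mul_div h0 hX)).ne'
  have hinner : HasDerivAt (fun t => exp 1 * X / f t) (-(exp 1 * X * f') / f ρ ^ 2) ρ := by
    simpa using (hasDerivAt_const ρ (exp 1 * X)).fun_div hf h0.ne'
  convert (hinner.log (by positivity)).log hlog using 1
  field_simp

theorem HasGrowth.neg_log_log {v v' : ℝ → ℝ} {M : ℝ} (hv : HasGrowth v v' M) (hβ : 0 < β)
    (hmem : ∀ ρ ∈ Set.Icc (0 : ℝ) 1, v ρ ∈ Set.Icc β X) (hX : X ≤ c * β) :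
    HasGrowth (fun ρ => -log (log (exp 1 * X / v ρ)))
      (fun ρ => v' ρ / (v ρ * log (exp 1 * X / v ρ))) (log (log (exp 1 * c))) where
  monotoneOn ρ hρ ρ' hρ' hle := neg_le_neg <|
    log_log_exp_mul_div_anti (hβ.trans_le (hmem ρ hρ).1) (hv.monotoneOn hρ hρ' hle) (hmem ρ' hρ').2
  hasDerivAt := by
    filter_upwards [hv.hasDerivAt] with ρ hderiv hρ
    have hvρ := hmem ρ (Set.Ioo_subset_Icc_self hρ)
    simpa using (hasDerivAt_log_log_exp_mul_div (hderiv hρ) (hβ.trans_le hvρ.1) hvρ.2).fun_neg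
  sub_le := by
    have h0 := hmem 0 (by simp)
    have h1 := hmem 1 (by simp)
    linarith [log_log_exp_mul_div_le hβ h0.1 h0.2 hX,
      log_log_exp_mul_div_nonneg (hβ.trans_le h1.1) h1.2]

theorem HasGrowth.log_log {w w' : ℝ → ℝ} {M : ℝ} (hw : HasGrowth (fun ρ => -w ρ) w' M) (hβ : 0 < β)
    (hmem : ∀ ρ ∈ Set.Icc (0 : ℝ) 1, w ρ ∈ Set.Icc β X) (hX : X ≤ c * β) :
    HasGrowth (fun ρ => log (log (exp 1 * X / w ρ)))
      (fun ρ => w' ρ / (w ρ * log (exp 1 * X / w ρ))) (log (log (exp 1 * c))) where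
  monotoneOn ρ hρ ρ' hρ' hle := log_log_exp_mul_div_anti (hβ.trans_le (hmem ρ' hρ').1)
    (neg_le_neg_iff.1 (hw.monotoneOn hρ hρ' hle)) (hmem ρ hρ).2
  hasDerivAt := by
    filter_upwards [hw.hasDerivAt] with ρ hderiv hρ
    have hwρ := hmem ρ (Set.Ioo_subset_Icc_self hρ)
    have hderiv' : HasDerivAt w (-w' ρ) ρ := by simpa using (hderiv hρ).fun_neg
    simpa [neg_div] using hasDerivAt_log_log_exp_mul_div hderiv' (hβ.trans_le hwρ.1) hwρ.2
  sub_le := by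
    have h0 := hmem 0 (by simp)
    have h1 := hmem 1 (by simp)
    linarith [log_log_exp_mul_div_le hβ h1.1 h1.2 hX,
      log_log_exp_mul_div_nonneg (hβ.trans_le h0.1) h0.2]

theorem log_log_exp_mul_pos (hc : 1 < c) : 0 < log (log (exp 1 * c)) := by
  rw [log_mul (exp_pos 1).ne' (by positivity), log_exp]
  exact log_pos (lt_add_of_pos_right 1 (log_pos hc))

end LogLog

/-! ### Volumes of growing balls -/

namespace MultiGraph

variable {V E : Type*} {G : MultiGraph V E}

theorem mem_ball {l : V → V → ℝ≥0∞} {S : Finset V} {z v : V} {ρ : ℝ} :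
    v ∈ ball l S z ρ ↔ v ∈ S ∧ l z v ≤ ENNReal.ofReal ρ := by
  simp only [ball, Finset.mem_filter]

theorem ball_subset (l : V → V → ℝ≥0∞) (S : Finset V) (z : V) (ρ : ℝ) : ball l S z ρ ⊆ S :=
  fun _ hv => (mem_ball.1 hv).1

open scoped Classical in
/-- The contribution of the edge `e` to `MultiGraph.volume`. -/
noncomputable def edgeVolume (G : MultiGraph V E) (l : V → V → ℝ≥0∞) (S : Finset V) (z : V)
    (e : E) (ρ : ℝ) : ℝ :=
  let B := ball l S z ρ
  (if G.left e ∈ B ∧ G.right e ∈ B then (l (G.left e) (G.right e)).toReal else 0)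
    + (if G.left e ∈ B ∧ G.right e ∈ S \ B then ρ - (l z (G.left e)).toReal else 0)
    + (if G.right e ∈ B ∧ G.left e ∈ S \ B then ρ - (l z (G.right e)).toReal else 0)

open scoped Classical in
/-- The contribution of the edge `e` to `MultiGraph.coVolume`. -/
noncomputable def edgeCoVolume (G : MultiGraph V E) (l : V → V → ℝ≥0∞) (S : Finset V) (z : V)
    (e : E) (ρ : ℝ) : ℝ :=
  let B := ball l S z ρ
  (if G.left e ∈ S \ B ∧ G.right e ∈ S \ B then (l (G.left e) (G.right e)).toReal else 0)
    + (if G.left e ∈ B ∧ G.right e ∈ S \ B then (l z (G.right e)).toReal - ρ else 0)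
    + (if G.right e ∈ B ∧ G.left e ∈ S \ B then (l z (G.left e)).toReal - ρ else 0)

theorem volume_eq (l : V → V → ℝ≥0∞) (F : Finset E) (S : Finset V) (β : ℝ) (z : V) (ρ : ℝ) :
    G.volume l F S β z ρ = β + ∑ e ∈ F, G.edgeVolume l S z e ρ := by
  simp only [volume, edgeVolume, Finset.sum_filter, Finset.sum_add_distrib, add_assoc]

theorem coVolume_eq (l : V → V → ℝ≥0∞) (F : Finset E) (S : Finset V) (β : ℝ) (z : V) (ρ : ℝ) :
    G.coVolume l F S β z ρ = β + ∑ e ∈ F, G.edgeCoVolume l S z e ρ := by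
  simp only [coVolume, edgeCoVolume, Finset.sum_filter, Finset.sum_add_distrib, add_assoc]

/-- The edge `e` leads from `A` to `S \ A`, in either direction; unlike `MultiGraph.boundary`, this
makes sense for infinitely many edges. -/
def IsCut (G : MultiGraph V E) (S A : Finset V) (e : E) : Prop :=
  G.left e ∈ A ∧ G.right e ∈ S ∧ G.right e ∉ A ∨ G.right e ∈ A ∧ G.left e ∈ S ∧ G.left e ∉ A

theorem mem_boundary_iff_isCut [Fintype E] {S A : Finset V} {e : E} :
    e ∈ G.boundary S A ↔ G.IsCut S A e := by
  rw [mem_boundary]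
  constructor
  · rintro ⟨u, hu, v, hv, hv', ⟨rfl, rfl⟩ | ⟨rfl, rfl⟩⟩
    exacts [Or.inl ⟨hu, hv, hv'⟩, Or.inr ⟨hu, hv, hv'⟩]
  · rintro (⟨hu, hv, hv'⟩ | ⟨hu, hv, hv'⟩)
    exacts [⟨_, hu, _, hv, hv', Or.inl ⟨rfl, rfl⟩⟩, ⟨_, hu, _, hv, hv', Or.inr ⟨rfl, rfl⟩⟩]

open scoped Classical in
/-- The growing balls of radius `ρ ∈ [0,R)` around `z` reach the near end of the edge `e` at radius
`a` and its far end at radius `b`, and the ends of `e` have distance `d`. The bound `R` makes room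
for edges at infinite distance from `z`, for which `a = b = R`; edges not inside `S` have
`a = b = d = 0`. -/
structure EdgeProfile (G : MultiGraph V E) (l : V → V → ℝ≥0∞) (S : Finset V) (z : V)
    (e : E) (R a b d : ℝ) : Prop where
  near_nonneg : 0 ≤ a
  near_le_far : a ≤ b
  far_le : b ≤ a + d
  isCut_iff : ∀ ρ ∈ Set.Ico 0 R, G.IsCut S (ball l S z ρ) e ↔ a ≤ ρ ∧ ρ < b
  mem_inside_ball_iff : ∀ ρ ∈ Set.Ico 0 R,
    e ∈ G.inside (ball l S z ρ) ↔ e ∈ G.inside S ∧ b ≤ ρ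
  mem_inside_sdiff_iff : ∀ ρ ∈ Set.Ico 0 R,
    e ∈ G.inside (S \ ball l S z ρ) ↔ e ∈ G.inside S ∧ ρ < a
  edgeVolume_eq : ∀ ρ ∈ Set.Ico 0 R,
    G.edgeVolume l S z e ρ = if b ≤ ρ then d else max 0 (ρ - a)
  edgeCoVolume_eq : ∀ ρ ∈ Set.Ico 0 R,
    G.edgeCoVolume l S z e ρ = if ρ < a then d else max 0 (b - ρ)
  dist_eq_zero : e ∉ G.inside S → d = 0

open scoped Classical in
theorem hasDerivAt_ite_max_sub {a b ρ : ℝ} (d : ℝ) (hab : a ≤ b) (ha : ρ ≠ a) (hb : ρ ≠ b) :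
    HasDerivAt (fun t => if b ≤ t then d else max 0 (t - a))
      (if a ≤ ρ ∧ ρ < b then 1 else 0) ρ := by
  rcases ha.lt_or_gt with hρa | hρa
  · rw [if_neg fun h => hρa.not_ge h.1]
    refine (hasDerivAt_const ρ (0 : ℝ)).congr_of_eventuallyEq ?_
    filter_upwards [Iio_mem_nhds hρa] with t ht
    grind
  rcases hb.lt_or_gt with hρb | hρb
  · rw [if_pos ⟨hρa.le, hρb⟩]
    refine ((hasDerivAt_id ρ).sub_const a).congr_of_eventuallyEq ?_
    filter_upwards [Ioo_mem_nhds hρa hρb] with t ht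
    grind
  · rw [if_neg fun h => hρb.not_gt h.2]
    refine (hasDerivAt_const ρ d).congr_of_eventuallyEq ?_
    filter_upwards [Ioi_mem_nhds hρb] with t ht
    grind

open scoped Classical in
theorem hasDerivAt_ite_max_const_sub {a b ρ : ℝ} (d : ℝ) (hab : a ≤ b) (ha : ρ ≠ a) (hb : ρ ≠ b) :
    HasDerivAt (fun t => if t < a then d else max 0 (b - t))
      (-if a ≤ ρ ∧ ρ < b then 1 else 0) ρ := by
  rcases ha.lt_or_gt with hρa | hρa
  · rw [if_neg fun h => hρa.not_ge h.1, neg_zero]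
    refine (hasDerivAt_const ρ d).congr_of_eventuallyEq ?_
    filter_upwards [Iio_mem_nhds hρa] with t ht
    grind
  rcases hb.lt_or_gt with hρb | hρb
  · rw [if_pos ⟨hρa.le, hρb⟩]
    refine ((hasDerivAt_id ρ).const_sub b).congr_of_eventuallyEq ?_
    filter_upwards [Ioo_mem_nhds hρa hρb] with t ht
    grind
  · rw [if_neg fun h => hρb.not_gt h.2, neg_zero]
    refine (hasDerivAt_const ρ (0 : ℝ)).congr_of_eventuallyEq ?_
    filter_upwards [Ioi_mem_nhds hρb] with t ht
    grind

section Profile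

variable {len : E → ℝ} {l : V → V → ℝ≥0∞} {S : Finset V} {z : V} {e : E}
  {R a b d : ℝ}

theorem edgeProfile_of_notMem_inside (he : e ∉ G.inside S) : G.EdgeProfile l S z e R 0 0 0 := by
  have hS : G.left e ∉ S ∨ G.right e ∉ S := not_and_or.1 he
  constructor <;> intros <;> rcases hS with hS | hS <;>
    simp_all [IsCut, inside, mem_ball, edgeVolume, edgeCoVolume]

theorem edgeProfile_of_dist_eq_top (hR : 0 ≤ R) (he : e ∈ G.inside S)
    (hleft : l z (G.left e) = ⊤) (hright : l z (G.right e) = ⊤) :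
    G.EdgeProfile l S z e R R R (l (G.left e) (G.right e)).toReal := by
  have hmem (ρ : ℝ) : G.left e ∉ ball l S z ρ ∧ G.right e ∉ ball l S z ρ := by
    simp [mem_ball, hleft, hright]
  have hS : G.left e ∈ S ∧ G.right e ∈ S := he
  constructor
  case isCut_iff => simp +contextual [IsCut, hmem]
  case mem_inside_ball_iff => simp +contextual [inside, hmem]
  case mem_inside_sdiff_iff => simp +contextual [inside, hmem, hS]
  case edgeVolume_eq =>
    intro ρ hρ
    simp [edgeVolume, hmem, hρ.2.not_ge, hρ.2.le]
  case edgeCoVolume_eq => simp +contextual [edgeCoVolume, hmem, hS]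
  all_goals simp [hR, he]

theorem edgeProfile_of_dist_eq_ofReal {A B D : ℝ} (he : e ∈ G.inside S) (hA : 0 ≤ A) (hB : 0 ≤ B)
    (hD : 0 ≤ D) (hAB : A ≤ B + D) (hBA : B ≤ A + D)
    (hleft : l z (G.left e) = ENNReal.ofReal A) (hright : l z (G.right e) = ENNReal.ofReal B)
    (hends : l (G.left e) (G.right e) = ENNReal.ofReal D) :
    G.EdgeProfile l S z e R (min A B) (max A B) D := by
  have hmem (ρ : ℝ) (hρ : 0 ≤ ρ) : (G.left e ∈ ball l S z ρ ↔ A ≤ ρ) ∧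
      (G.right e ∈ ball l S z ρ ↔ B ≤ ρ) := by
    simp [mem_ball, hleft, hright, he.1, he.2, ENNReal.ofReal_le_ofReal_iff hρ]
  have hS : G.left e ∈ S ∧ G.right e ∈ S := he
  constructor
  case isCut_iff =>
    intro ρ hρ
    simp only [IsCut, hmem ρ hρ.1, hS]
    grind
  case mem_inside_ball_iff =>
    intro ρ hρ
    simp [inside, hmem ρ hρ.1, hS]
  case mem_inside_sdiff_iff =>
    intro ρ hρ
    simp [inside, hmem ρ hρ.1, hS]
  case edgeVolume_eq =>
    intro ρ hρ
    simp only [edgeVolume, hmem ρ hρ.1, hS, Finset.mem_sdiff, hleft, hright, hends,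
      ENNReal.toReal_ofReal, hA, hB, hD]
    grind
  case edgeCoVolume_eq =>
    intro ρ hρ
    simp only [edgeCoVolume, hmem ρ hρ.1, hS, Finset.mem_sdiff, hleft, hright, hends,
      ENNReal.toReal_ofReal, hA, hB, hD]
    grind
  all_goals grind

theorem exists_edgeProfile (hlen : ∀ e, 0 ≤ len e) (hR : 0 ≤ R) (S : Finset V) (z : V) (e : E) :
    ∃ a b d, d ≤ len e ∧ G.EdgeProfile (G.pathDist len) S z e R a b d := by
  by_cases he : e ∈ G.inside S
  swap
  · exact ⟨0, 0, 0, hlen e, edgeProfile_of_notMem_inside he⟩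
  have hends := pathDist_le_of_joins len (G.joins_left_right e)
  have hends_top : G.pathDist len (G.left e) (G.right e) ≠ ⊤ :=
    ne_top_of_le_ne_top ENNReal.ofReal_ne_top hends
  have hd : (G.pathDist len (G.left e) (G.right e)).toReal ≤ len e :=
    ENNReal.toReal_le_of_le_ofReal (hlen e) hends
  have hleft := pathDist_triangle (G := G) hlen z (G.right e) (G.left e)
  have hright := pathDist_triangle (G := G) hlen z (G.left e) (G.right e)
  rw [pathDist_comm hlen (G.right e) (G.left e)] at hleft
  by_cases htop : G.pathDist len z (G.left e) = ⊤
  · have htop' : G.pathDist len z (G.right e) = ⊤ :=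
      (ENNReal.add_eq_top.1 (top_le_iff.1 (htop ▸ hleft))).resolve_right hends_top
    exact ⟨R, R, _, hd, edgeProfile_of_dist_eq_top hR he htop htop'⟩
  · have htop' : G.pathDist len z (G.right e) ≠ ⊤ :=
      ne_top_of_le_ne_top (ENNReal.add_ne_top.2 ⟨htop, hends_top⟩) hright
    refine ⟨_, _, _, hd, edgeProfile_of_dist_eq_ofReal he ENNReal.toReal_nonneg
      ENNReal.toReal_nonneg ENNReal.toReal_nonneg ?_ ?_ (ENNReal.ofReal_toReal htop).symm
      (ENNReal.ofReal_toReal htop').symm (ENNReal.ofReal_toReal hends_top).symm⟩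
    · rw [← ENNReal.toReal_add htop' hends_top]
      exact ENNReal.toReal_mono (ENNReal.add_ne_top.2 ⟨htop', hends_top⟩) hleft
    · rw [← ENNReal.toReal_add htop hends_top]
      exact ENNReal.toReal_mono (ENNReal.add_ne_top.2 ⟨htop, hends_top⟩) hright

namespace EdgeProfile

variable (h : G.EdgeProfile l S z e R a b d)
include h

theorem edgeVolume_mono {ρ ρ' : ℝ} (h0 : 0 ≤ ρ) (hle : ρ ≤ ρ') (hR : ρ' < R) :
    G.edgeVolume l S z e ρ ≤ G.edgeVolume l S z e ρ' := by
  rw [h.edgeVolume_eq ρ ⟨h0, hle.trans_lt hR⟩, h.edgeVolume_eq ρ' ⟨h0.trans hle, hR⟩]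
  grind [h.far_le, h.near_le_far]

theorem edgeCoVolume_anti {ρ ρ' : ℝ} (h0 : 0 ≤ ρ) (hle : ρ ≤ ρ') (hR : ρ' < R) :
    G.edgeCoVolume l S z e ρ' ≤ G.edgeCoVolume l S z e ρ := by
  rw [h.edgeCoVolume_eq ρ ⟨h0, hle.trans_lt hR⟩, h.edgeCoVolume_eq ρ' ⟨h0.trans hle, hR⟩]
  grind [h.far_le, h.near_le_far]

theorem edgeVolume_nonneg {ρ : ℝ} (hρ : ρ ∈ Set.Ico 0 R) : 0 ≤ G.edgeVolume l S z e ρ := by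
  rw [h.edgeVolume_eq ρ hρ]
  grind [h.far_le, h.near_le_far]

theorem edgeCoVolume_nonneg {ρ : ℝ} (hρ : ρ ∈ Set.Ico 0 R) : 0 ≤ G.edgeCoVolume l S z e ρ := by
  rw [h.edgeCoVolume_eq ρ hρ]
  grind [h.far_le, h.near_le_far]

open scoped Classical in
theorem edgeVolume_le {c ρ : ℝ} (hd : d ≤ c) (hρ : ρ ∈ Set.Ico 0 R) :
    G.edgeVolume l S z e ρ ≤
      (if e ∈ G.inside S then c else 0) - if e ∈ G.inside (S \ ball l S z ρ) then c else 0 := by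
  rw [h.edgeVolume_eq ρ hρ]
  simp only [h.mem_inside_sdiff_iff ρ hρ]
  grind [h.far_le, h.near_le_far, h.dist_eq_zero]

open scoped Classical in
theorem edgeCoVolume_le {c ρ : ℝ} (hd : d ≤ c) (hρ : ρ ∈ Set.Ico 0 R) :
    G.edgeCoVolume l S z e ρ ≤
      (if e ∈ G.inside S then c else 0) - if e ∈ G.inside (ball l S z ρ) then c else 0 := by
  rw [h.edgeCoVolume_eq ρ hρ]
  simp only [h.mem_inside_ball_iff ρ hρ]
  grind [h.far_le, h.near_le_far, h.dist_eq_zero]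

open scoped Classical in
theorem hasDerivAt_edgeVolume {ρ : ℝ} (hρ : ρ ∈ Set.Ioo 0 R) (ha : ρ ≠ a) (hb : ρ ≠ b) :
    HasDerivAt (G.edgeVolume l S z e) (if G.IsCut S (ball l S z ρ) e then 1 else 0) ρ := by
  have heq : G.edgeVolume l S z e =ᶠ[nhds ρ] fun ρ => if b ≤ ρ then d else max 0 (ρ - a) := by
    filter_upwards [Ioo_mem_nhds hρ.1 hρ.2] with t ht
    exact h.edgeVolume_eq t (Set.Ioo_subset_Ico_self ht)
  simp only [h.isCut_iff ρ (Set.Ioo_subset_Ico_self hρ)]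
  exact (hasDerivAt_ite_max_sub d h.near_le_far ha hb).congr_of_eventuallyEq heq

open scoped Classical in
theorem hasDerivAt_edgeCoVolume {ρ : ℝ} (hρ : ρ ∈ Set.Ioo 0 R) (ha : ρ ≠ a) (hb : ρ ≠ b) :
    HasDerivAt (fun ρ => -G.edgeCoVolume l S z e ρ)
      (if G.IsCut S (ball l S z ρ) e then 1 else 0) ρ := by
  have heq : G.edgeCoVolume l S z e =ᶠ[nhds ρ] fun ρ => if ρ < a then d else max 0 (b - ρ) := by
    filter_upwards [Ioo_mem_nhds hρ.1 hρ.2] with t ht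
    exact h.edgeCoVolume_eq t (Set.Ioo_subset_Ico_self ht)
  simp only [h.isCut_iff ρ (Set.Ioo_subset_Ico_self hρ)]
  simpa only [neg_neg] using
    ((hasDerivAt_ite_max_const_sub d h.near_le_far ha hb).congr_of_eventuallyEq heq).fun_neg

end EdgeProfile

end Profile

section Volume

variable {len : E → ℝ} (hlen : ∀ e, 0 ≤ len e) (F : Finset E) (S : Finset V) (β : ℝ)
  (z : V)
include hlen

theorem volume_mono {ρ ρ' : ℝ} (h0 : 0 ≤ ρ) (hle : ρ ≤ ρ') :
    G.volume (G.pathDist len) F S β z ρ ≤ G.volume (G.pathDist len) F S β z ρ' := by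
  simp only [volume_eq]
  gcongr with e
  obtain ⟨a, b, d, -, h⟩ :=
    exists_edgeProfile (G := G) hlen (add_nonneg (h0.trans hle) zero_le_one) S z e
  exact h.edgeVolume_mono h0 hle (lt_add_one ρ')

theorem coVolume_anti {ρ ρ' : ℝ} (h0 : 0 ≤ ρ) (hle : ρ ≤ ρ') :
    G.coVolume (G.pathDist len) F S β z ρ' ≤ G.coVolume (G.pathDist len) F S β z ρ := by
  simp only [coVolume_eq]
  gcongr with e
  obtain ⟨a, b, d, -, h⟩ :=
    exists_edgeProfile (G := G) hlen (add_nonneg (h0.trans hle) zero_le_one) S z e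
  exact h.edgeCoVolume_anti h0 hle (lt_add_one ρ')

variable {ρ R : ℝ}

theorem le_volume (h0 : 0 ≤ ρ) : β ≤ G.volume (G.pathDist len) F S β z ρ := by
  rw [volume_eq]
  refine le_add_of_nonneg_right (Finset.sum_nonneg fun e _ => ?_)
  obtain ⟨a, b, d, -, h⟩ := exists_edgeProfile (G := G) hlen (add_nonneg h0 zero_le_one) S z e
  exact h.edgeVolume_nonneg ⟨h0, lt_add_one ρ⟩

theorem le_coVolume (h0 : 0 ≤ ρ) : β ≤ G.coVolume (G.pathDist len) F S β z ρ := by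
  rw [coVolume_eq]
  refine le_add_of_nonneg_right (Finset.sum_nonneg fun e _ => ?_)
  obtain ⟨a, b, d, -, h⟩ := exists_edgeProfile (G := G) hlen (add_nonneg h0 zero_le_one) S z e
  exact h.edgeCoVolume_nonneg ⟨h0, lt_add_one ρ⟩

open scoped Classical in
theorem volume_le (h0 : 0 ≤ ρ) : G.volume (G.pathDist len) F S β z ρ ≤
    β + (∑ e ∈ F with e ∈ G.inside S, len e -
      ∑ e ∈ F with e ∈ G.inside (S \ ball (G.pathDist len) S z ρ), len e) := by
  rw [volume_eq, Finset.sum_filter, Finset.sum_filter, ← Finset.sum_sub_distrib]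
  gcongr with e
  obtain ⟨a, b, d, hd, h⟩ := exists_edgeProfile (G := G) hlen (add_nonneg h0 zero_le_one) S z e
  exact h.edgeVolume_le hd ⟨h0, lt_add_one ρ⟩

open scoped Classical in
theorem coVolume_le (h0 : 0 ≤ ρ) : G.coVolume (G.pathDist len) F S β z ρ ≤
    β + (∑ e ∈ F with e ∈ G.inside S, len e -
      ∑ e ∈ F with e ∈ G.inside (ball (G.pathDist len) S z ρ), len e) := by
  rw [coVolume_eq, Finset.sum_filter, Finset.sum_filter, ← Finset.sum_sub_distrib]
  gcongr with e
  obtain ⟨a, b, d, hd, h⟩ := exists_edgeProfile (G := G) hlen (add_nonneg h0 zero_le_one) S z e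
  exact h.edgeCoVolume_le hd ⟨h0, lt_add_one ρ⟩

open scoped Classical in
theorem ae_hasDerivAt_volume [Fintype E] (hR : 0 ≤ R) : ∀ᵐ ρ, ρ ∈ Set.Ioo 0 R →
    HasDerivAt (G.volume (G.pathDist len) F S β z)
      (F.filter (· ∈ G.boundary S (ball (G.pathDist len) S z ρ))).card ρ := by
  choose a b d _ h using exists_edgeProfile (G := G) hlen hR S z
  filter_upwards [((Set.finite_range a).union (Set.finite_range b)).countable.ae_notMem _]
    with ρ hρ hmem
  simp only [funext (volume_eq (G.pathDist len) F S β z), Finset.natCast_card_filter,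
    mem_boundary_iff_isCut]
  refine (HasDerivAt.fun_sum fun e _ => (h e).hasDerivAt_edgeVolume hmem ?_ ?_).const_add β
  · exact fun hab => hρ (Or.inl ⟨e, hab.symm⟩)
  · exact fun hab => hρ (Or.inr ⟨e, hab.symm⟩)

open scoped Classical in
theorem ae_hasDerivAt_neg_coVolume [Fintype E] (hR : 0 ≤ R) : ∀ᵐ ρ, ρ ∈ Set.Ioo 0 R →
    HasDerivAt (fun ρ => -G.coVolume (G.pathDist len) F S β z ρ)
      (F.filter (· ∈ G.boundary S (ball (G.pathDist len) S z ρ))).card ρ := by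
  choose a b d _ h using exists_edgeProfile (G := G) hlen hR S z
  filter_upwards [((Set.finite_range a).union (Set.finite_range b)).countable.ae_notMem _]
    with ρ hρ hmem
  simp only [coVolume_eq, neg_add, ← Finset.sum_neg_distrib, Finset.natCast_card_filter,
    mem_boundary_iff_isCut]
  refine (HasDerivAt.fun_sum fun e _ => (h e).hasDerivAt_edgeCoVolume hmem ?_ ?_).const_add (-β)
  · exact fun hab => hρ (Or.inl ⟨e, hab.symm⟩)
  · exact fun hab => hρ (Or.inr ⟨e, hab.symm⟩)

end Volume

end MultiGraph

/-! ### Good radii -/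

namespace RoundingData

variable {V E : Type*} {r : ℕ}

section Definitions

variable [Fintype E] (D : RoundingData V E r)

/-- The volume `𝒱(ρ)`, which counts the `x`-edges inside the ball of radius `ρ` around `s i`. -/
noncomputable def ballVolume (S : Finset V) (i : Fin r) (ρ : ℝ) : ℝ :=
  D.graph.volume (D.dist i) D.F S D.β (D.s i) ρ

/-- The complementary volume, which counts the `x`-edges inside `S` and outside the ball of radius
`ρ` around `s i`. -/
noncomputable def coBallVolume (S : Finset V) (i : Fin r) (ρ : ℝ) : ℝ :=
  D.graph.coVolume (D.dist i) D.F S D.β (D.s i) ρ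

open scoped Classical in
/-- The volume of the ball with respect to the edges that are not `x`-edges, with base value `0`. -/
noncomputable def yVolume (S : Finset V) (i : Fin r) (ρ : ℝ) : ℝ :=
  D.graph.volume (D.dist i) D.Fᶜ S 0 (D.s i) ρ

open scoped Classical in
/-- The number of `x`-edges leaving the ball. -/
noncomputable def xCut (S : Finset V) (i : Fin r) (ρ : ℝ) : ℝ :=
  (D.F.filter (· ∈ D.graph.boundary S (D.ball S i ρ))).card

open scoped Classical in
/-- The number of edges leaving the ball that are not `x`-edges. -/
noncomputable def yCut (S : Finset V) (i : Fin r) (ρ : ℝ) : ℝ :=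
  (D.Fᶜ.filter (· ∈ D.graph.boundary S (D.ball S i ρ))).card

open scoped Classical in
/-- The total `x`-value of the edges inside `S`. -/
noncomputable def weight (S : Finset V) : ℝ := ∑ e with e ∈ D.graph.inside S, D.x e

/-- What the analysis of the algorithm uses of the subdivided graph and its fractional solution:
`x` lives on the `x`-edges, the `y i` live on the other edges, and terminals of a pair have
distance at least `1`. -/
structure Admissible : Prop where
  x_nonneg : ∀ e, 0 ≤ D.x e
  y_nonneg : ∀ i e, 0 ≤ D.y i e
  x_eq_zero : ∀ e ∉ D.F, D.x e = 0
  y_eq_zero : ∀ i, ∀ e ∈ D.F, D.y i e = 0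
  one_le_dist : ∀ i, 1 ≤ D.dist i (D.s i) (D.t i)

end Definitions

/-- The factor between the cut and `W ln(e𝒱ˣ(S)/W)` in `RoundingData.GoodRadius`. -/
noncomputable def cutFactor (γ : ℝ) (r : ℕ) : ℝ :=
  2 * γ / (√γ - 1) ^ 2 * Real.log (Real.log (Real.exp 1 * (r + 1)))

theorem log_log_exp_mul_succ_pos (i : Fin r) :
    0 < Real.log (Real.log (Real.exp 1 * (r + 1))) :=
  log_log_exp_mul_pos (by simpa using i.pos)

theorem source_mem_ball {D : RoundingData V E r} {S : Finset V} {i : Fin r} (hs : D.s i ∈ S)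
    (ρ : ℝ) : D.s i ∈ D.ball S i ρ :=
  MultiGraph.mem_ball.2 ⟨hs, by simp [dist]⟩

theorem Admissible.len_nonneg {D : RoundingData V E r} (hD : D.Admissible) (i : Fin r) (e : E) :
    0 ≤ D.x e + D.y i e :=
  add_nonneg (hD.x_nonneg e) (hD.y_nonneg i e)

theorem Admissible.sink_notMem_ball {D : RoundingData V E r} (hD : D.Admissible) (S : Finset V)
    (i : Fin r) {ρ : ℝ} (hρ : ρ < 1) : D.t i ∉ D.ball S i ρ := fun h =>
  hρ.not_ge (ENNReal.one_le_ofReal.1 ((hD.one_le_dist i).trans (MultiGraph.mem_ball.1 h).2))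

variable [Fintype E] {D : RoundingData V E r} {S : Finset V} {i : Fin r} {γ ρ κ : ℝ}

theorem goodRadius_iff : D.GoodRadius γ S i ρ ↔ ρ ∈ Set.Ico 0 1 ∧
    ∀ W ∈ ({D.ballVolume S i ρ, D.coBallVolume S i ρ} : Set ℝ),
      (D.graph.boundary S (D.ball S i ρ)).card ≤
        cutFactor γ r * (W * Real.log (Real.exp 1 * D.xVolume S / W)) := by
  simp only [GoodRadius, cutFactor, ballVolume, coBallVolume, Set.mem_Ico, Set.mem_insert_iff,
    Set.mem_singleton_iff, forall_eq_or_imp, forall_eq, and_assoc]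
  ring_nf

open scoped Classical in
theorem card_boundary_eq (D : RoundingData V E r) (S : Finset V) (i : Fin r) (ρ : ℝ) :
    (D.graph.boundary S (D.ball S i ρ)).card = D.xCut S i ρ + D.yCut S i ρ := by
  rw [xCut, yCut, ← Nat.cast_add, ← Finset.card_union_of_disjoint
    (Finset.disjoint_filter_filter disjoint_compl_right), ← Finset.filter_union,
    Finset.union_compl, Finset.filter_univ_mem]

theorem xVolume_eq (D : RoundingData V E r) (S : Finset V) : D.xVolume S = D.β + D.weight S := rfl

namespace Admissible

variable (hD : D.Admissible)
include hD

theorem opt_nonneg : 0 ≤ D.opt := Finset.sum_nonneg fun e _ => hD.x_nonneg e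

theorem weight_nonneg (S : Finset V) : 0 ≤ D.weight S :=
  Finset.sum_nonneg fun e _ => hD.x_nonneg e

theorem weight_le_opt (S : Finset V) : D.weight S ≤ D.opt :=
  Finset.sum_le_univ_sum_of_nonneg hD.x_nonneg

open scoped Classical in
theorem weight_add_weight_sdiff_le {A S : Finset V} (h : A ⊆ S) :
    D.weight A + D.weight (S \ A) ≤ D.weight S := by
  rw [weight, weight, ← Finset.sum_union]
  · refine Finset.sum_le_sum_of_subset_of_nonneg (fun e => ?_) fun e _ _ => hD.x_nonneg e
    simp only [Finset.mem_union, Finset.mem_filter_univ]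
    rintro (he | he)
    · exact ⟨h he.1, h he.2⟩
    · exact ⟨Finset.sdiff_subset he.1, Finset.sdiff_subset he.2⟩
  · rw [Finset.disjoint_filter]
    exact fun e _ hA hS => (Finset.mem_sdiff.1 hS.1).2 hA.1

theorem xVolume_le (hr : 0 < r) (S : Finset V) : D.xVolume S ≤ (r + 1) * D.β := by
  have hopt : r * D.β = D.opt := mul_div_cancel₀ _ (Nat.cast_pos.2 hr).ne'
  linarith [D.xVolume_eq S, hD.weight_le_opt S]

open scoped Classical in
theorem sum_len_eq_weight (i : Fin r) (S : Finset V) :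
    ∑ e ∈ D.F with e ∈ D.graph.inside S, (D.x e + D.y i e) = D.weight S := by
  rw [weight, Finset.sum_filter, Finset.sum_filter]
  refine Finset.sum_subset_zero_on_sdiff (Finset.subset_univ _) (fun e he => ?_) fun e he => ?_
  · simp [hD.x_eq_zero e (Finset.mem_sdiff.1 he).2]
  · simp [hD.y_eq_zero i e he]

open scoped Classical in
theorem ballVolume_le (S : Finset V) (i : Fin r) (h0 : 0 ≤ ρ) :
    D.ballVolume S i ρ ≤ D.β + (D.weight S - D.weight (S \ D.ball S i ρ)) := by
  rw [← hD.sum_len_eq_weight i S, ← hD.sum_len_eq_weight i (S \ D.ball S i ρ)]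
  exact MultiGraph.volume_le (hD.len_nonneg i) D.F S D.β (D.s i) h0

theorem coBallVolume_le (S : Finset V) (i : Fin r) (h0 : 0 ≤ ρ) :
    D.coBallVolume S i ρ ≤ D.β + (D.weight S - D.weight (D.ball S i ρ)) := by
  rw [← hD.sum_len_eq_weight i S, ← hD.sum_len_eq_weight i (D.ball S i ρ)]
  exact MultiGraph.coVolume_le (hD.len_nonneg i) D.F S D.β (D.s i) h0

theorem ballVolume_mem_Icc (S : Finset V) (i : Fin r) (h0 : 0 ≤ ρ) :
    D.ballVolume S i ρ ∈ Set.Icc D.β (D.xVolume S) := by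
  classical
  refine ⟨MultiGraph.le_volume (hD.len_nonneg i) D.F S D.β (D.s i) h0, ?_⟩
  linarith [hD.ballVolume_le S i h0, hD.weight_nonneg (S \ D.ball S i ρ), D.xVolume_eq S]

theorem coBallVolume_mem_Icc (S : Finset V) (i : Fin r) (h0 : 0 ≤ ρ) :
    D.coBallVolume S i ρ ∈ Set.Icc D.β (D.xVolume S) := by
  refine ⟨MultiGraph.le_coVolume (hD.len_nonneg i) D.F S D.β (D.s i) h0, ?_⟩
  linarith [hD.coBallVolume_le S i h0, hD.weight_nonneg (D.ball S i ρ), D.xVolume_eq S]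

theorem yVolume_le (hy : ∑ e, D.y i e ≤ κ) (S : Finset V) (h0 : 0 ≤ ρ) :
    D.yVolume S i ρ ≤ κ := by
  classical
  calc D.yVolume S i ρ
      ≤ 0 + (∑ e ∈ D.Fᶜ with e ∈ D.graph.inside S, (D.x e + D.y i e) -
          ∑ e ∈ D.Fᶜ with e ∈ D.graph.inside (S \ D.ball S i ρ), (D.x e + D.y i e)) := by
        exact MultiGraph.volume_le (hD.len_nonneg i) D.Fᶜ S 0 (D.s i) h0
    _ ≤ ∑ e ∈ D.Fᶜ with e ∈ D.graph.inside S, (D.x e + D.y i e) := by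
        rw [zero_add]
        exact sub_le_self _ (Finset.sum_nonneg fun e _ => hD.len_nonneg i e)
    _ = ∑ e ∈ D.Fᶜ with e ∈ D.graph.inside S, D.y i e := by
        refine Finset.sum_congr rfl fun e he => ?_
        rw [hD.x_eq_zero e (Finset.mem_compl.1 (Finset.mem_filter.1 he).1), zero_add]
    _ ≤ ∑ e, D.y i e := Finset.sum_le_univ_sum_of_nonneg (hD.y_nonneg i)
    _ ≤ κ := hy

theorem hasGrowth_yVolume (hy : ∑ e, D.y i e ≤ κ) (S : Finset V) :
    HasGrowth (D.yVolume S i) (D.yCut S i) κ where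
  monotoneOn _ hρ _ _ hle := MultiGraph.volume_mono (hD.len_nonneg i) _ S 0 (D.s i) hρ.1 hle
  hasDerivAt := MultiGraph.ae_hasDerivAt_volume (hD.len_nonneg i) _ S 0 (D.s i) zero_le_one
  sub_le := (sub_le_self _ (MultiGraph.le_volume (hD.len_nonneg i) _ S 0 (D.s i) le_rfl)).trans
    (hD.yVolume_le hy S zero_le_one)

theorem hasGrowth_ballVolume (S : Finset V) (i : Fin r) :
    HasGrowth (D.ballVolume S i) (D.xCut S i) (D.weight S) where
  monotoneOn _ hρ _ _ hle := MultiGraph.volume_mono (hD.len_nonneg i) _ S _ (D.s i) hρ.1 hle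
  hasDerivAt := MultiGraph.ae_hasDerivAt_volume (hD.len_nonneg i) _ S _ (D.s i) zero_le_one
  sub_le := by
    linarith [(hD.ballVolume_mem_Icc S i zero_le_one).2, (hD.ballVolume_mem_Icc S i le_rfl).1,
      D.xVolume_eq S]

theorem hasGrowth_neg_coBallVolume (S : Finset V) (i : Fin r) :
    HasGrowth (fun ρ => -D.coBallVolume S i ρ) (D.xCut S i) (D.weight S) where
  monotoneOn _ hρ _ _ hle :=
    neg_le_neg (MultiGraph.coVolume_anti (hD.len_nonneg i) _ S _ (D.s i) hρ.1 hle)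
  hasDerivAt := MultiGraph.ae_hasDerivAt_neg_coVolume (hD.len_nonneg i) _ S _ (D.s i) zero_le_one
  sub_le := by
    linarith [(hD.coBallVolume_mem_Icc S i zero_le_one).1, (hD.coBallVolume_mem_Icc S i le_rfl).2,
      D.xVolume_eq S]

-- The budgets `1/σ`, `(σ-1)/(2σ)`, `(σ-1)/(2σ)` of the three potentials add up to `1`.
theorem exists_radius (hβ : 0 < D.β) (hy : ∑ e, D.y i e ≤ κ) (hκ : 0 < κ) {σ : ℝ} (hσ : 1 < σ)
    (S : Finset V) : ∃ ρ ∈ Set.Ioo (0 : ℝ) 1, D.yCut S i ρ ≤ σ * κ ∧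
      ∀ W ∈ ({D.ballVolume S i ρ, D.coBallVolume S i ρ} : Set ℝ),
        D.xCut S i ρ ≤ 2 * σ / (σ - 1) * Real.log (Real.log (Real.exp 1 * (r + 1))) *
          (W * Real.log (Real.exp 1 * D.xVolume S / W)) := by
  have hL := log_log_exp_mul_succ_pos i
  have hX := hD.xVolume_le i.pos S
  set L := Real.log (Real.log (Real.exp 1 * (r + 1)))
  set X := D.xVolume S
  have hσ0 : 0 < σ := zero_lt_one.trans hσ
  have : 0 < σ - 1 := sub_pos.2 hσ
  set a := 2 * σ / (σ - 1) * L with ha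
  have ha0 : 0 < a := by positivity
  have hvol := (hD.hasGrowth_ballVolume S i).neg_log_log hβ
    (fun ρ hρ => hD.ballVolume_mem_Icc S i hρ.1) hX
  have hcovol := (hD.hasGrowth_neg_coBallVolume S i).log_log hβ
    (fun ρ hρ => hD.coBallVolume_mem_Icc S i hρ.1) hX
  let f' : Fin 3 → ℝ → ℝ := ![D.yCut S i,
    fun ρ => D.xCut S i ρ / (D.ballVolume S i ρ * Real.log (Real.exp 1 * X / D.ballVolume S i ρ)),
    fun ρ => D.xCut S i ρ /
      (D.coBallVolume S i ρ * Real.log (Real.exp 1 * X / D.coBallVolume S i ρ))]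
  obtain ⟨ρ, hρ, hle⟩ := HasGrowth.exists_mem_Ioo_forall_le (ι := Fin 3)
    (f := ![D.yVolume S i, _, _]) (f' := f') (M := ![κ, L, L]) (c := ![σ * κ, a, a])
    (Fin.forall_fin_succ.2 ⟨hD.hasGrowth_yVolume hy S, Fin.forall_fin_two.2 ⟨hvol, hcovol⟩⟩)
    (Fin.forall_fin_succ.2 ⟨mul_pos hσ0 hκ, Fin.forall_fin_two.2 ⟨ha0, ha0⟩⟩) (by
      simp only [Fin.sum_univ_three, Matrix.cons_val]
      rw [ha]
      field_simp
      linarith)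
  have hxCut (W : ℝ) (hW : W ∈ Set.Icc D.β X)
      (hle : D.xCut S i ρ / (W * Real.log (Real.exp 1 * X / W)) ≤ a) :
      D.xCut S i ρ ≤ a * (W * Real.log (Real.exp 1 * X / W)) :=
    (div_le_iff₀ (mul_log_exp_mul_div_pos (hβ.trans_le hW.1) hW.2)).1 hle
  refine ⟨ρ, hρ, hle 0, ?_⟩
  rintro W (rfl | rfl)
  · exact hxCut _ (hD.ballVolume_mem_Icc S i hρ.1.le) (hle 1)
  · exact hxCut _ (hD.coBallVolume_mem_Icc S i hρ.1.le) (hle 2)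

theorem le_card_boundary {q : ℝ} (hs : D.s i ∈ S)
    (hc : D.graph.AtLeastConnected (D.graph.inside S) (D.s i) (D.t i) q) (hρ : ρ < 1) :
    q ≤ (D.graph.boundary S (D.ball S i ρ)).card := by
  obtain ⟨m, hm, hp⟩ := hc
  exact hm.trans
    (Nat.cast_le.2 (hp.le_card_boundary (source_mem_ball hs ρ) (hD.sink_notMem_ball S i hρ)))

theorem xCut_eq_zero (hx : ∀ e, D.x e = 0) (S : Finset V) (i : Fin r) (ρ : ℝ) :
    D.xCut S i ρ = 0 := by
  classical
  rw [xCut, Nat.cast_eq_zero, Finset.card_eq_zero, Finset.filter_eq_empty_iff]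
  intro e he hcut
  obtain ⟨u, hu, v, hv, hv', hjoins⟩ := MultiGraph.mem_boundary.1 hcut
  have hdist : D.dist i u v = 0 := by
    simpa [dist, hx e, hD.y_eq_zero i e he] using
      MultiGraph.pathDist_le_of_joins (fun e => D.x e + D.y i e) hjoins
  refine hv' (MultiGraph.mem_ball.2 ⟨hv, ?_⟩)
  calc D.dist i (D.s i) v ≤ D.dist i (D.s i) u + D.dist i u v :=
        MultiGraph.pathDist_triangle (hD.len_nonneg i) _ u v
    _ ≤ ENNReal.ofReal ρ := by simpa [hdist] using (MultiGraph.mem_ball.1 hu).2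

theorem β_nonneg : 0 ≤ D.β := div_nonneg hD.opt_nonneg (Nat.cast_nonneg r)

theorem x_eq_zero_of_β_eq_zero (hr : 0 < r) (hβ : D.β = 0) (e : E) : D.x e = 0 := by
  have hopt : D.opt = 0 := (div_eq_zero_iff.1 hβ).resolve_right (Nat.cast_pos.2 hr).ne'
  exact (Finset.sum_eq_zero_iff_of_nonneg fun e _ => hD.x_nonneg e).1 hopt e (Finset.mem_univ e)

theorem β_pos (hy : ∑ e, D.y i e ≤ κ) (hκ : 0 < κ) (hγ : 1 < γ) (hs : D.s i ∈ S)
    (hc : D.graph.AtLeastConnected (D.graph.inside S) (D.s i) (D.t i) (γ * κ)) : 0 < D.β := by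
  refine hD.β_nonneg.lt_of_ne fun hβ => ?_
  obtain ⟨ρ, hρ, hle⟩ := HasGrowth.exists_mem_Ioo_forall_le (ι := Unit) (c := fun _ => κ)
    (fun _ => hD.hasGrowth_yVolume hy S) (fun _ => hκ) (by simp [hκ.ne'])
  have hcut : γ * κ ≤ D.xCut S i ρ + D.yCut S i ρ :=
    (hD.le_card_boundary hs hc hρ.2).trans_eq (D.card_boundary_eq S i ρ)
  rw [hD.xCut_eq_zero (hD.x_eq_zero_of_β_eq_zero i.pos hβ.symm)] at hcut
  linarith [hle (), lt_mul_of_one_lt_left hκ hγ]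

-- At least `γκ` edges are cut, of which at most `√γκ` are not `x`-edges.
theorem exists_goodRadius (hy : ∑ e, D.y i e ≤ κ) (hκ : 0 < κ) (hγ : 1 < γ) (hs : D.s i ∈ S)
    (hc : D.graph.AtLeastConnected (D.graph.inside S) (D.s i) (D.t i) (γ * κ)) :
    ∃ ρ, D.GoodRadius γ S i ρ := by
  have hσ : 1 < √γ := Real.lt_sqrt_of_sq_lt (by simpa using hγ)
  obtain ⟨ρ, hρ, hyCut, hxCut⟩ := hD.exists_radius (hD.β_pos hy hκ hγ hs hc) hy hκ hσ S
  refine ⟨ρ, goodRadius_iff.2 ⟨⟨hρ.1.le, hρ.2⟩, fun W hW => ?_⟩⟩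
  have hsq : √γ * √γ = γ := Real.mul_self_sqrt (by linarith)
  have hσ1 : 0 < √γ - 1 := sub_pos.2 hσ
  have hcut := D.card_boundary_eq S i ρ
  have hle := hD.le_card_boundary hs hc hρ.2
  have hcard : (D.graph.boundary S (D.ball S i ρ)).card ≤ √γ / (√γ - 1) * D.xCut S i ρ := by
    rw [div_mul_eq_mul_div, le_div_iff₀ hσ1]
    nlinarith
  calc ((D.graph.boundary S (D.ball S i ρ)).card : ℝ)
    _ ≤ √γ / (√γ - 1) * D.xCut S i ρ := hcard
    _ ≤ √γ / (√γ - 1) * (2 * √γ / (√γ - 1) * Real.log (Real.log (Real.exp 1 * (r + 1))) *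
          (W * Real.log (Real.exp 1 * D.xVolume S / W))) := by
        gcongr
        exact hxCut W hW
    _ = 2 * (√γ * √γ) / (√γ - 1) ^ 2 * Real.log (Real.log (Real.exp 1 * (r + 1))) *
          (W * Real.log (Real.exp 1 * D.xVolume S / W)) := by
        field_simp
    _ = cutFactor γ r * (W * Real.log (Real.exp 1 * D.xVolume S / W)) := by
        rw [hsq, cutFactor]

end Admissible

end RoundingData

/-! ### Termination and correctness of the algorithm -/

namespace RoundingData

variable {V E : Type*} {r : ℕ} {D : RoundingData V E r} {T : Finset (Fin r)} {S A : Finset V}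
  {i : Fin r} {γ ρ : ℝ} {k : ℕ} {χ : Choices V r}

theorem mem_pairsIn : i ∈ D.pairsIn T S ↔ i ∈ T ∧ D.s i ∈ S ∧ D.t i ∈ S := by
  simp [pairsIn]

theorem card_pairsIn_le (D : RoundingData V E r) (T : Finset (Fin r)) (S : Finset V) :
    (D.pairsIn T S).card ≤ T.card :=
  Finset.card_le_card fun _ hi => (mem_pairsIn.1 hi).1

theorem mem_active : i ∈ D.active γ k T S ↔ i ∈ D.pairsIn T S ∧
    D.graph.AtLeastConnected (D.graph.inside S) (D.s i) (D.t i) (γ * ((k : ℝ) - 1)) := by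
  simp [active]

open scoped Classical in
theorem disjoint_pairsIn_sdiff (D : RoundingData V E r) (T : Finset (Fin r)) (S A : Finset V) :
    Disjoint (D.pairsIn T A) (D.pairsIn T (S \ A)) :=
  Finset.disjoint_left.2 fun _ h h' =>
    (Finset.mem_sdiff.1 (mem_pairsIn.1 h').2.1).2 (mem_pairsIn.1 h).2.1

open scoped Classical in
theorem pairsIn_union_sdiff_subset (hA : A ⊆ S) :
    D.pairsIn T A ∪ D.pairsIn T (S \ A) ⊆ D.pairsIn T S := by
  intro i hi
  simp only [Finset.mem_union, mem_pairsIn, Finset.mem_sdiff] at hi ⊢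
  rcases hi with ⟨hT, hs, ht⟩ | ⟨hT, hs, ht⟩
  exacts [⟨hT, hA hs, hA ht⟩, ⟨hT, hs.1, ht.1⟩]

open scoped Classical in
theorem card_pairsIn_add_le (hA : A ⊆ S) :
    (D.pairsIn T A).card + (D.pairsIn T (S \ A)).card ≤ (D.pairsIn T S).card := by
  rw [← Finset.card_union_of_disjoint (D.disjoint_pairsIn_sdiff T S A)]
  exact Finset.card_le_card (pairsIn_union_sdiff_subset hA)

open scoped Classical in
theorem card_pairsIn_add_lt (hA : A ⊆ S) (hi : i ∈ D.pairsIn T S)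
    (hsep : D.s i ∈ A ↔ D.t i ∉ A) :
    (D.pairsIn T A).card + (D.pairsIn T (S \ A)).card < (D.pairsIn T S).card := by
  rw [← Finset.card_union_of_disjoint (D.disjoint_pairsIn_sdiff T S A)]
  refine Finset.card_lt_card ((Finset.ssubset_iff_of_subset (pairsIn_union_sdiff_subset hA)).2
    ⟨i, hi, ?_⟩)
  simp only [Finset.mem_union, mem_pairsIn, Finset.mem_sdiff]
  tauto

theorem region_subset (D : RoundingData V E r) (T : Finset (Fin r)) (S : Finset V) (i : Fin r)
    (ρ : ℝ) : D.region T S i ρ ⊆ S := by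
  classical
  unfold region
  split_ifs
  exacts [MultiGraph.ball_subset _ _ _ _, Finset.sdiff_subset]

theorem nextRegion_subset (D : RoundingData V E r) (χ : Choices V r) (T : Finset (Fin r))
    (S : Finset V) : D.nextRegion χ T S ⊆ S :=
  D.region_subset T S _ _

theorem two_mul_card_pairsIn_region_le (D : RoundingData V E r) (T : Finset (Fin r))
    (S : Finset V) (i : Fin r) (ρ : ℝ) : 2 * (D.pairsIn T (D.region T S i ρ)).card ≤ T.card := by
  classical
  unfold region
  split_ifs with h
  · exact h
  · have hadd := D.card_pairsIn_add_le (T := T) (MultiGraph.ball_subset (D.dist i) S (D.s i) ρ)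
    have hle := D.card_pairsIn_le T S
    rw [ball] at h ⊢
    omega

theorem Admissible.source_mem_region_iff (hD : D.Admissible) (hi : i ∈ D.pairsIn T S)
    (hρ : ρ < 1) : D.s i ∈ D.region T S i ρ ↔ D.t i ∉ D.region T S i ρ := by
  obtain ⟨-, hs, ht⟩ := mem_pairsIn.1 hi
  have hsB := source_mem_ball hs ρ
  have htB := hD.sink_notMem_ball S i hρ
  unfold region
  split_ifs
  · tauto
  · simp [hsB, htB, ht]

variable [Fintype E]

open scoped Classical in
theorem Admissible.exists_card_boundary_region_le (hD : D.Admissible) (T : Finset (Fin r))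
    (hρ : D.GoodRadius γ S i ρ) :
    ∃ W ∈ Set.Icc D.β (D.β + (D.weight S - D.weight (S \ D.region T S i ρ))),
      (D.graph.boundary S (D.region T S i ρ)).card ≤
        cutFactor γ r * (W * Real.log (Real.exp 1 * D.xVolume S / W)) := by
  obtain ⟨⟨h0, -⟩, hcut⟩ := goodRadius_iff.1 hρ
  have hball : D.ball S i ρ ⊆ S := MultiGraph.ball_subset _ _ _ _
  unfold region
  split_ifs
  · exact ⟨_, ⟨(hD.ballVolume_mem_Icc S i h0).1, hD.ballVolume_le S i h0⟩, hcut _ (by simp)⟩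
  · rw [MultiGraph.boundary_sdiff hball, Finset.sdiff_sdiff_eq_self hball]
    exact ⟨_, ⟨(hD.coBallVolume_mem_Icc S i h0).1, hD.coBallVolume_le S i h0⟩, hcut _ (by simp)⟩

theorem ValidChoices.exists_nextRegion_eq (hχ : D.ValidChoices γ k χ)
    (hact : (D.active γ k T S).Nonempty) :
    ∃ i ∈ D.pairsIn T S, ∃ ρ, D.GoodRadius γ S i ρ ∧ D.nextRegion χ T S = D.region T S i ρ := by
  obtain ⟨hi, hc⟩ := mem_active.1 (hχ.1 T S hact)
  have hi' := mem_active.2 ⟨mem_pairsIn.2 ⟨Finset.mem_univ _, (mem_pairsIn.1 hi).2⟩, hc⟩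
  exact ⟨_, hi, _, hχ.2 S _ hi', rfl⟩

theorem Admissible.exists_separated_nextRegion (hD : D.Admissible) (hχ : D.ValidChoices γ k χ)
    (hact : (D.active γ k T S).Nonempty) :
    ∃ i ∈ D.pairsIn T S, D.s i ∈ D.nextRegion χ T S ↔ D.t i ∉ D.nextRegion χ T S := by
  obtain ⟨i, hi, ρ, hρ, h⟩ := hχ.exists_nextRegion_eq hact
  exact ⟨i, hi, h ▸ hD.source_mem_region_iff hi hρ.2.1⟩

open scoped Classical in
theorem Admissible.nextRegion_ssubset (hD : D.Admissible) (hχ : D.ValidChoices γ k χ)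
    (hact : (D.active γ k T S).Nonempty) :
    D.nextRegion χ T S ⊂ S ∧ S \ D.nextRegion χ T S ⊂ S := by
  obtain ⟨i, hi, hsep⟩ := hD.exists_separated_nextRegion hχ hact
  obtain ⟨-, hs, ht⟩ := mem_pairsIn.1 hi
  have hsub := D.nextRegion_subset χ T S
  refine ⟨hsub.ssubset_of_ne fun h => ?_, Finset.sdiff_ssubset hsub ?_⟩
  · simp [h, hs, ht] at hsep
  · exact Finset.nonempty_iff_ne_empty.2 fun h => by simp [h] at hsep

theorem Admissible.exists_carve (hD : D.Admissible) (hχ : D.ValidChoices γ k χ)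
    (T : Finset (Fin r)) (S : Finset V) :
    ∃ 𝒮 Z, D.Carve γ k χ T S 𝒮 Z ∧ ∀ A ∈ 𝒮, A ⊂ S := by
  classical
  induction S using Finset.strongInduction with
  | H S ih =>
    rcases (D.active γ k T S).eq_empty_or_nonempty with hact | hact
    · exact ⟨[], ∅, .done S hact, by simp⟩
    · obtain ⟨hregion, hrest⟩ := hD.nextRegion_ssubset hχ hact
      obtain ⟨𝒮, Z, hcarve, h𝒮⟩ := ih _ hrest
      exact ⟨_, _, .step S 𝒮 Z hact hcarve,
        List.forall_mem_cons.2 ⟨hregion, fun A hA => (h𝒮 A hA).trans hrest⟩⟩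

theorem Admissible.exists_returns (hD : D.Admissible) (hχ : D.ValidChoices γ k χ)
    (U : Finset V) (T : Finset (Fin r)) : ∃ Z, D.Returns γ k χ U T Z := by
  classical
  induction U using Finset.strongInduction generalizing T with
  | H U ih =>
    obtain ⟨𝒮, Z, hcarve, h𝒮⟩ := hD.exists_carve hχ T U
    have hrec (A : Finset V) : ∃ Z', A ∈ 𝒮 → D.Returns γ k χ A (D.pairsIn T A) Z' := by
      by_cases hA : A ∈ 𝒮
      · exact (ih A (h𝒮 A hA) _).imp fun _ h _ => h
      · exact ⟨∅, fun h => absurd h hA⟩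
    choose R hR using hrec
    exact ⟨_, .call U T 𝒮 Z R hcarve hR⟩

theorem Admissible.exists_validChoices (hD : D.Admissible)
    (hy : ∀ i, ∑ e, D.y i e ≤ (k : ℝ) - 1) (hr : 0 < r) (hk : 1 < k) (hγ : 1 < γ) :
    ∃ χ, D.ValidChoices γ k χ := by
  have hpick (T S) : ∃ i : Fin r, (D.active γ k T S).Nonempty → i ∈ D.active γ k T S := by
    by_cases hact : (D.active γ k T S).Nonempty
    · exact hact.imp fun _ hi _ => hi
    · exact ⟨⟨0, hr⟩, fun h => absurd h hact⟩
  have hradius (S i) : ∃ ρ, i ∈ D.active γ k Finset.univ S → D.GoodRadius γ S i ρ := by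
    by_cases hi : i ∈ D.active γ k Finset.univ S
    · obtain ⟨hi, hc⟩ := mem_active.1 hi
      have hκ : (0 : ℝ) < k - 1 := sub_pos.2 (Nat.one_lt_cast.2 hk)
      exact (hD.exists_goodRadius (hy i) hκ hγ (mem_pairsIn.1 hi).2.1 hc).imp fun _ hρ _ => hρ
    · exact ⟨0, fun h => absurd h hi⟩
  choose pick hpick using hpick
  choose radius hradius using hradius
  exact ⟨⟨pick, radius⟩, hpick, fun S i hi => hradius S i hi⟩

section Correctness

variable {Z : Finset E} {Q : Set E} {m : ℕ}

theorem exists_region_of_carve {𝒮 : List (Finset V)} (hcarve : D.Carve γ k χ T S 𝒮 Z)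
    (hQ : ∀ e ∈ Q, e ∉ Z) (hi : i ∈ T) (hs : D.s i ∈ S) (hm : 0 < m)
    (hq : γ * ((k : ℝ) - 1) ≤ m)
    (hP : D.graph.HasDisjointPaths (D.graph.inside S ∩ Q) (D.s i) (D.t i) m) :
    ∃ A ∈ 𝒮, D.s i ∈ A ∧ D.t i ∈ A ∧
      D.graph.HasDisjointPaths (D.graph.inside A ∩ Q) (D.s i) (D.t i) m := by
  classical
  induction hcarve with
  | done S h =>
    have ht := (hP.inside_of_closed hs hm fun e he a _ b hj => (hj.mem_inside_iff.1 he.1).2).1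
    obtain ⟨P, hP, hd⟩ := hP
    have hact : i ∈ D.active γ k T S := mem_active.2 ⟨mem_pairsIn.2 ⟨hi, hs, ht⟩, m, hq, P,
      fun j => ⟨(hP j).1, fun e he => ((hP j).2 e he).1⟩, hd⟩
    simp [h] at hact
  | step S 𝒮 Z _ next ih =>
    set A := D.nextRegion χ T S
    have hcut : ∀ e ∈ D.graph.inside S ∩ Q, ∀ a ∈ A, ∀ b ∉ A, ¬ D.graph.Joins e a b :=
      fun e he a ha b hb hj => hQ e he.2 (Finset.mem_union_left _
        (MultiGraph.mem_boundary.2 ⟨a, ha, b, (hj.mem_inside_iff.1 he.1).2, hb, hj⟩))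
    by_cases hsA : D.s i ∈ A
    · obtain ⟨ht, hP'⟩ := hP.inside_of_closed hsA hm fun e he a ha b hj =>
        by_contra fun hb => hcut e he a ha b hb hj
      exact ⟨A, List.mem_cons_self, hsA, ht, hP'⟩
    · have hsR : D.s i ∈ S \ A := Finset.mem_sdiff.2 ⟨hs, hsA⟩
      obtain ⟨-, hP'⟩ := hP.inside_of_closed hsR hm fun e he a ha b hj =>
        Finset.mem_sdiff.2 ⟨(hj.mem_inside_iff.1 he.1).2,
          fun hb => hcut e he b hb a (Finset.mem_sdiff.1 ha).2 hj.symm⟩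
      obtain ⟨B, hB, h⟩ := ih (fun e he hZ => hQ e he (Finset.mem_union_right _ hZ)) hsR hP'
      exact ⟨B, List.mem_cons_of_mem _ hB, h⟩

theorem not_hasDisjointPaths_of_returns {U : Finset V} (hreturns : D.Returns γ k χ U T Z)
    (hQ : ∀ e ∈ Q, e ∉ Z) (hi : i ∈ T) (hs : D.s i ∈ U) (hm : 0 < m)
    (hq : γ * ((k : ℝ) - 1) ≤ m) :
    ¬ D.graph.HasDisjointPaths (D.graph.inside U ∩ Q) (D.s i) (D.t i) m := by
  classical
  induction hreturns with
  | call U T 𝒮 Z R loop _ ih =>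
    intro hP
    obtain ⟨A, hA, hsA, htA, hPA⟩ := exists_region_of_carve loop
      (fun e he hZ => hQ e he (Finset.mem_union_left _ hZ)) hi hs hm hq hP
    refine ih A hA (fun e he hZ => hQ e he (Finset.mem_union_right _ ?_))
      (mem_pairsIn.2 ⟨hi, hsA, htA⟩) hsA hPA
    exact Finset.mem_biUnion.2 ⟨A, List.mem_toFinset.2 hA, hZ⟩

end Correctness

end RoundingData

/-! ### The cost of the returned cut -/

section CutEstimate

open Real

theorem mul_log_exp_mul_div_le_of_le {X W W' : ℝ} (hW : 0 < W) (hWW' : W ≤ W') (hX : W' ≤ X) :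
    W * log (exp 1 * X / W) ≤ W' * log (exp 1 * X / W') := by
  have hW' : 0 < W' := hW.trans_le hWW'
  have hX0 : 0 < X := hW'.trans_le hX
  have hsplit : log (exp 1 * X / W) = log (exp 1 * X / W') + log (W' / W) := by
    rw [← log_mul (by positivity) (by positivity)]
    field_simp
  have hlog : W * log (W' / W) ≤ W' - W :=
    calc W * log (W' / W) ≤ W * (W' / W - 1) := by
          gcongr
          exact log_le_sub_one_of_pos (by positivity)
      _ = W' - W := by field_simp
  nlinarith [one_le_log_exp_mul_div hW' hX]

theorem mul_log_exp_mul_div_le {β δ R X W : ℝ} (hβ : 0 < β) (hW : W ∈ Set.Icc β (β + δ))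
    (hX : β + δ ≤ X) (hR : X ≤ R * β) :
    W * log (exp 1 * X / W) ≤
      β * log (exp 1 * R) + δ * (1 + log (X / β) - log ((β + δ) / β)) := by
  have hδ : 0 < β + δ := hβ.trans_le (hW.1.trans hW.2)
  have hX0 : 0 < X := hδ.trans_le hX
  have hlog : log (exp 1 * X / (β + δ)) = 1 + log (X / β) - log ((β + δ) / β) := by
    rw [log_div (by positivity) hδ.ne', log_mul (by positivity) hX0.ne', log_exp,
      log_div hX0.ne' hβ.ne', log_div hδ.ne' hβ.ne']
    ring
  have hlog_le : log (exp 1 * X / (β + δ)) ≤ log (exp 1 * R) := by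
    refine log_le_log (by positivity) ((div_le_div_of_nonneg_left (by positivity) hβ
      (hW.1.trans hW.2)).trans ?_)
    rw [mul_div_assoc]
    gcongr
    exact (div_le_iff₀ hβ).2 hR
  calc W * log (exp 1 * X / W)
      ≤ (β + δ) * log (exp 1 * X / (β + δ)) :=
        mul_log_exp_mul_div_le_of_le (hβ.trans_le hW.1) hW.2 hX
    _ = β * log (exp 1 * X / (β + δ)) + δ * log (exp 1 * X / (β + δ)) := add_mul _ _ _
    _ ≤ β * log (exp 1 * R) + δ * (1 + log (X / β) - log ((β + δ) / β)) := by
        rw [← hlog]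
        gcongr

theorem log_exp_mul_succ_nonneg (r : ℕ) : 0 ≤ log (exp 1 * (r + 1)) :=
  log_nonneg (one_le_mul_of_one_le_of_one_le (one_le_exp zero_le_one) (by simp))

theorem natLog_two_mul_succ_le {a n : ℕ} (h : 2 * a ≤ n) (hn : 0 < n) :
    Nat.log 2 (2 * a) + 1 ≤ Nat.log 2 (2 * n) := by
  rw [mul_comm 2 n, Nat.log_mul_base one_lt_two hn.ne']
  gcongr

end CutEstimate

theorem card_biUnion_toFinset_le {α β : Type*} [DecidableEq α] [DecidableEq β] (l : List α)
    (f : α → Finset β) : (l.toFinset.biUnion f).card ≤ (l.map fun a => (f a).card).sum := by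
  induction l with
  | nil => simp
  | cons a l ih =>
    rw [List.toFinset_cons, Finset.biUnion_insert, List.map_cons, List.sum_cons]
    exact (Finset.card_union_le _ _).trans (Nat.add_le_add_left ih _)

namespace RoundingData

variable {V E : Type*} [Fintype E] {r : ℕ} {D : RoundingData V E r} {T : Finset (Fin r)}
  {S A U : Finset V} {γ : ℝ} {k : ℕ} {χ : Choices V r} {Z : Finset E}

/-- The bound, up to the factor `cutFactor γ r`, on the cost of a call whose node set is `S` and
which has to separate `n` out of its `N` pairs. -/
noncomputable def costBound (D : RoundingData V E r) (S : Finset V) (N n : ℕ) : ℝ :=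
  D.weight S * (Nat.log 2 (2 * N) + Real.log (D.xVolume S / D.β)) +
    D.β * n * Real.log (Real.exp 1 * (r + 1))

theorem cutFactor_nonneg (hγ : 0 ≤ γ) (hr : 0 < r) : 0 ≤ cutFactor γ r := by
  have hlog := log_log_exp_mul_succ_pos ⟨0, hr⟩
  unfold cutFactor
  positivity

namespace Admissible

variable (hD : D.Admissible)
include hD

theorem weight_mono (hA : A ⊆ S) : D.weight A ≤ D.weight S := by
  classical
  linarith [hD.weight_add_weight_sdiff_le hA, hD.weight_nonneg (S \ A)]

theorem log_xVolume_div_nonneg (S : Finset V) : 0 ≤ Real.log (D.xVolume S / D.β) := by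
  rcases hD.β_nonneg.eq_or_lt with hβ | hβ
  · simp [← hβ]
  · refine Real.log_nonneg ((one_le_div hβ).2 ?_)
    linarith [D.xVolume_eq S, hD.weight_nonneg S]

theorem costBound_nonneg (S : Finset V) (N n : ℕ) : 0 ≤ D.costBound S N n := by
  have hw := hD.weight_nonneg S
  have hβ := hD.β_nonneg
  have hlog := hD.log_xVolume_div_nonneg S
  have hlog' := log_exp_mul_succ_nonneg r
  unfold costBound
  positivity

theorem costBound_mono (S : Finset V) (N : ℕ) {n n' : ℕ} (h : n ≤ n') :
    D.costBound S N n ≤ D.costBound S N n' := by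
  have hβ := hD.β_nonneg
  have hlog := log_exp_mul_succ_nonneg r
  unfold costBound
  gcongr

theorem costBound_eq_zero (hr : 0 < r) (hβ : D.β = 0) (S : Finset V) (N n : ℕ) :
    D.costBound S N n = 0 := by
  simp [costBound, weight, hβ, hD.x_eq_zero_of_β_eq_zero hr hβ]

theorem costBound_le_of_two_mul_le {δ : ℝ} (hβ : 0 < D.β) (hδ : D.weight A ≤ δ) {N n : ℕ}
    (hN : 0 < N) (hn : 2 * n ≤ N) :
    D.costBound A n n ≤ δ * (Nat.log 2 (2 * N) - 1 + Real.log ((D.β + δ) / D.β)) +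
      D.β * n * Real.log (Real.exp 1 * (r + 1)) := by
  have hw := hD.weight_nonneg A
  have hδ0 := hw.trans hδ
  have hlog := hD.log_xVolume_div_nonneg A
  have hX : 0 < D.xVolume A := by linarith [D.xVolume_eq A]
  have hXδ : D.xVolume A ≤ D.β + δ := by linarith [D.xVolume_eq A]
  have hlogN : (Nat.log 2 (2 * n) : ℝ) ≤ Nat.log 2 (2 * N) - 1 := by
    rw [le_sub_iff_add_le]
    exact_mod_cast natLog_two_mul_succ_le hn hN
  unfold costBound
  gcongr

theorem costBound_le_of_subset (hβ : 0 < D.β) (hA : A ⊆ S) (N n : ℕ) :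
    D.costBound A N n ≤ D.weight A * (Nat.log 2 (2 * N) + Real.log (D.xVolume S / D.β)) +
      D.β * n * Real.log (Real.exp 1 * (r + 1)) := by
  have hw := hD.weight_nonneg A
  have hX : 0 < D.xVolume A := by linarith [D.xVolume_eq A]
  have hXS : D.xVolume A ≤ D.xVolume S := by
    linarith [D.xVolume_eq A, D.xVolume_eq S, hD.weight_mono hA]
  unfold costBound
  gcongr

open scoped Classical in
theorem add_costBound_le (hr : 0 < r) (hA : A ⊆ S) {N nA nR nS : ℕ} (hN : 0 < N)
    (hnA : 2 * nA ≤ N) (hn : nA + nR < nS) {W : ℝ}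
    (hW : W ∈ Set.Icc D.β (D.β + (D.weight S - D.weight (S \ A)))) :
    W * Real.log (Real.exp 1 * D.xVolume S / W) + D.costBound A nA nA +
      D.costBound (S \ A) N nR ≤ D.costBound S N nS := by
  rcases hD.β_nonneg.eq_or_lt with hβ | hβ
  · have hW0 : W = 0 := by
      simpa [weight, ← hβ, hD.x_eq_zero_of_β_eq_zero hr hβ.symm] using hW
    simp [hW0, hD.costBound_eq_zero hr hβ.symm]
  have hwR := hD.weight_nonneg (S \ A)
  have hadd := hD.weight_add_weight_sdiff_le hA
  have hX := D.xVolume_eq S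
  have hc := log_exp_mul_succ_nonneg r
  set δ := D.weight S - D.weight (S \ A) with hδ
  set c := Real.log (Real.exp 1 * (r + 1))
  -- The call on `A` gives back `δ ln((β+δ)/β)`, and the halving of `N` pays for `δ`.
  have hcut := mul_log_exp_mul_div_le hβ hW (by linarith) (hD.xVolume_le hr S)
  have hregion := hD.costBound_le_of_two_mul_le hβ (A := A) (δ := δ) (by linarith) hN hnA
  have hrest := hD.costBound_le_of_subset hβ (Finset.sdiff_subset : S \ A ⊆ S) N nR
  have hpairs : (nA + nR + 1 : ℝ) ≤ nS := by exact_mod_cast hn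
  calc W * Real.log (Real.exp 1 * D.xVolume S / W) + D.costBound A nA nA +
        D.costBound (S \ A) N nR
      ≤ (D.β * c + δ * (1 + Real.log (D.xVolume S / D.β) - Real.log ((D.β + δ) / D.β))) +
        (δ * (Nat.log 2 (2 * N) - 1 + Real.log ((D.β + δ) / D.β)) + D.β * nA * c) +
        (D.weight (S \ A) * (Nat.log 2 (2 * N) + Real.log (D.xVolume S / D.β)) +
          D.β * nR * c) := by gcongr
    _ = D.weight S * (Nat.log 2 (2 * N) + Real.log (D.xVolume S / D.β)) +
        D.β * (nA + nR + 1) * c := by rw [hδ]; ring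
    _ ≤ D.costBound S N nS := by
        unfold costBound
        gcongr

theorem carve_cost_le (hγ : 0 ≤ γ) (hr : 0 < r) (hχ : D.ValidChoices γ k χ)
    {𝒮 : List (Finset V)} (hcarve : D.Carve γ k χ T S 𝒮 Z) :
    Z.card + (𝒮.map fun A =>
        cutFactor γ r * D.costBound A (D.pairsIn T A).card (D.pairsIn T A).card).sum ≤
      cutFactor γ r * D.costBound S T.card (D.pairsIn T S).card := by
  classical
  have hP : 0 ≤ cutFactor γ r := cutFactor_nonneg hγ hr
  induction hcarve with
  | done S h => simpa using mul_nonneg hP (hD.costBound_nonneg S _ _)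
  | step S 𝒮 Z h _ ih =>
    obtain ⟨i, hi, ρ, hρ, hregion⟩ := hχ.exists_nextRegion_eq h
    rw [hregion] at ih ⊢
    have hA : D.region T S i ρ ⊆ S := D.region_subset T S i ρ
    have hsep := hD.source_mem_region_iff hi hρ.2.1
    obtain ⟨W, hW, hcut⟩ := hD.exists_card_boundary_region_le T hρ
    have hstep := mul_le_mul_of_nonneg_left (hD.add_costBound_le hr hA
      (Finset.card_pos.2 ⟨i, (mem_pairsIn.1 hi).1⟩) (D.two_mul_card_pairsIn_region_le T S i ρ)
      (card_pairsIn_add_lt hA hi hsep) hW) hP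
    have hunion : ((D.graph.boundary S (D.region T S i ρ) ∪ Z).card : ℝ) ≤
        (D.graph.boundary S (D.region T S i ρ)).card + Z.card :=
      mod_cast Finset.card_union_le _ _
    rw [List.map_cons, List.sum_cons]
    linarith

theorem returns_cost_le (hγ : 0 ≤ γ) (hr : 0 < r) (hχ : D.ValidChoices γ k χ)
    (hreturns : D.Returns γ k χ U T Z) :
    Z.card ≤ cutFactor γ r * D.costBound U T.card T.card := by
  classical
  induction hreturns with
  | call U T 𝒮 Z R loop _ ih =>
    have hrec : ((𝒮.toFinset.biUnion R).card : ℝ) ≤ (𝒮.map fun A =>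
        cutFactor γ r * D.costBound A (D.pairsIn T A).card (D.pairsIn T A).card).sum :=
      calc ((𝒮.toFinset.biUnion R).card : ℝ)
          ≤ (𝒮.map fun A => ((R A).card : ℝ)).sum := by
            simpa [Function.comp_def] using
              Nat.cast_le (α := ℝ).2 (card_biUnion_toFinset_le 𝒮 R)
        _ ≤ _ := List.sum_le_sum fun A hA => ih A hA
    calc ((Z ∪ 𝒮.toFinset.biUnion R).card : ℝ)
        ≤ Z.card + (𝒮.toFinset.biUnion R).card := mod_cast Finset.card_union_le _ _
      _ ≤ _ := add_le_add_right hrec _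
      _ ≤ cutFactor γ r * D.costBound U T.card (D.pairsIn T U).card :=
        hD.carve_cost_le hγ hr hχ loop
      _ ≤ cutFactor γ r * D.costBound U T.card T.card := by
        gcongr
        · exact cutFactor_nonneg hγ hr
        · exact hD.costBound_mono U _ (D.card_pairsIn_le T U)

end Admissible

end RoundingData

/-! ### The subdivided graph -/

namespace MultiGraph

variable {V E : Type*} {G : MultiGraph V E} {r : ℕ}

theorem subNode_zero (e : E) : G.subNode r e 0 = Sum.inl (G.left e) := rfl

theorem subNode_last (e : E) : G.subNode r e (r + 1) = Sum.inl (G.right e) := by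
  simp [subNode]

theorem subNode_succ (e : E) (m : Fin r) : G.subNode r e (m + 1) = Sum.inr (e, m) := by
  simp [subNode]

theorem joins_subdivide (e : E) (m : Fin (r + 1)) :
    (G.subdivide r).Joins (e, m) (G.subNode r e m) (G.subNode r e (m + 1)) :=
  joins_left_right _ _

theorem exists_walk_subNode_iff {L : Set E} {e : E} (he : e ∈ L) {w : V ⊕ (E × Fin r)} {m : ℕ}
    (hm : m ≤ r + 1) :
    (∃ q : (G.subdivide r).Walk (G.subNode r e m) w, ∀ f ∈ q.edges, f.1 ∈ L) ↔
      ∃ q : (G.subdivide r).Walk (Sum.inl (G.left e)) w, ∀ f ∈ q.edges, f.1 ∈ L := by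
  induction m with
  | zero => rfl
  | succ m ih =>
    have hj := joins_subdivide (G := G) e ⟨m, hm⟩
    rw [← ih (by omega)]
    exact ⟨fun ⟨q, hq⟩ => ⟨.cons _ hj q, List.forall_mem_cons.2 ⟨he, hq⟩⟩,
      fun ⟨q, hq⟩ => ⟨.cons _ hj.symm q, List.forall_mem_cons.2 ⟨he, hq⟩⟩⟩

theorem Walk.exists_subdivide {L : Set E} {u v : V} (p : G.Walk u v) (hp : ∀ e ∈ p.edges, e ∈ L) :
    ∃ q : (G.subdivide r).Walk (Sum.inl u) (Sum.inl v), ∀ f ∈ q.edges, f.1 ∈ L := by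
  induction p with
  | nil u => exact ⟨.nil _, by simp [Walk.edges]⟩
  | @cons a b c e h p ih =>
    obtain ⟨he, htail⟩ := List.forall_mem_cons.1 hp
    have hiff := exists_walk_subNode_iff (G := G) (r := r) (w := Sum.inl c) he le_rfl
    rw [subNode_last] at hiff
    rcases h with ⟨rfl, rfl⟩ | ⟨rfl, rfl⟩
    exacts [hiff.1 (ih htail), hiff.2 (ih htail)]

theorem HasDisjointPaths.subdivide {F : Set E} {u v : V} {m : ℕ} (h : G.HasDisjointPaths F u v m) :
    (G.subdivide r).HasDisjointPaths {f | f.1 ∈ F} (Sum.inl u) (Sum.inl v) m := by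
  obtain ⟨P, hP, hd⟩ := h
  have hlift : ∀ j, ∃ q : (G.subdivide r).Walk (Sum.inl u) (Sum.inl v), q.IsPath ∧
      ∀ f ∈ q.edges, f.1 ∈ (P j).edges := fun j => by
    obtain ⟨q, hq⟩ := (P j).exists_subdivide (r := r) (L := {e | e ∈ (P j).edges}) fun _ => id
    obtain ⟨q', hq', hsub⟩ := q.exists_isPath
    exact ⟨q', hq', fun f hf => hq f (hsub.subset hf)⟩
  choose q hq hqP using hlift
  exact ⟨q, fun j => ⟨hq j, fun f hf => (hP j).2 _ (hqP j f hf)⟩,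
    fun j j' hne f hf hf' => hd j j' hne (hqP j f hf) (hqP j' f hf')⟩

/-- The distance of the `m`-th node on the path that replaces `e` from a source whose distances to
the vertices of `G` are `d`, when the pieces of that path have the lengths `l`: the node is reached
through one of the two ends of `e`. -/
noncomputable def subNodeDist (G : MultiGraph V E) (d : V → ℝ≥0∞)
    (l : E × Fin (r + 1) → ℝ≥0∞) (e : E) (m : ℕ) : ℝ≥0∞ :=
  min (d (G.left e) + ∑ j : Fin (r + 1) with j.val < m, l (e, j))
    (d (G.right e) + ∑ j : Fin (r + 1) with m ≤ j.val, l (e, j))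

/-- The extension to the subdivided graph, by `subNodeDist`, of the distances `d` from a source to
the vertices of `G`. -/
noncomputable def extendDist (G : MultiGraph V E) (d : V → ℝ≥0∞) (l : E × Fin (r + 1) → ℝ≥0∞) :
    V ⊕ (E × Fin r) → ℝ≥0∞ :=
  Sum.elim d fun f => G.subNodeDist d l f.1 (f.2 + 1)

section ExtendDist

variable {d : V → ℝ≥0∞} {l : E × Fin (r + 1) → ℝ≥0∞}

theorem extendDist_subNode (hd : ∀ e a b, G.Joins e a b → d b ≤ d a + ∑ j, l (e, j)) (e : E) {m : ℕ}
    (hm : m ≤ r + 1) : G.extendDist d l (G.subNode r e m) = G.subNodeDist d l e m := by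
  have hlr := hd e _ _ (joins_left_right G e)
  have hrl := hd e _ _ (joins_left_right G e).symm
  rcases m with _ | m
  · simp [subNode_zero, extendDist, subNodeDist, hrl]
  rcases (Nat.le_of_succ_le_succ hm).lt_or_eq with hlt | rfl
  · exact congrArg (G.extendDist d l) (subNode_succ e ⟨m, hlt⟩)
  · have hnone (j : Fin (m + 1)) : ¬ m < j := j.is_le.not_gt
    simp [subNode_last, extendDist, subNodeDist, Fin.is_le, hnone, hlr]

theorem sum_val_lt_succ (c : Fin (r + 1) → ℝ≥0∞) (m : Fin (r + 1)) :
    ∑ j : Fin (r + 1) with j.val < m.val + 1, c j =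
      ∑ j : Fin (r + 1) with j.val < m.val, c j + c m := by
  rw [add_comm (Finset.sum _ _), ← Finset.sum_insert (by simp)]
  congr 1
  ext j
  simp only [Finset.mem_filter_univ, Finset.mem_insert, Fin.ext_iff]
  omega

theorem sum_le_val (c : Fin (r + 1) → ℝ≥0∞) (m : Fin (r + 1)) :
    ∑ j : Fin (r + 1) with m.val ≤ j.val, c j =
      ∑ j : Fin (r + 1) with m.val + 1 ≤ j.val, c j + c m := by
  rw [add_comm (Finset.sum _ _), ← Finset.sum_insert (by simp)]
  congr 1
  ext j
  simp only [Finset.mem_filter_univ, Finset.mem_insert, Fin.ext_iff]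
  omega

theorem subNodeDist_succ_le (e : E) (m : Fin (r + 1)) :
    G.subNodeDist d l e (m + 1) ≤ G.subNodeDist d l e m + l (e, m) := by
  rw [subNodeDist, subNodeDist, sum_val_lt_succ, sum_le_val, min_add]
  exact min_le_min (add_assoc _ _ _).ge ((add_le_add_right le_self_add _).trans le_self_add)

theorem subNodeDist_le_succ (e : E) (m : Fin (r + 1)) :
    G.subNodeDist d l e m ≤ G.subNodeDist d l e (m + 1) + l (e, m) := by
  rw [subNodeDist, subNodeDist, sum_val_lt_succ, sum_le_val, min_add]
  exact min_le_min ((add_le_add_right le_self_add _).trans le_self_add) (add_assoc _ _ _).ge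

theorem extendDist_le_add (hd : ∀ e a b, G.Joins e a b → d b ≤ d a + ∑ j, l (e, j))
    {f : E × Fin (r + 1)} {a b : V ⊕ (E × Fin r)} (h : (G.subdivide r).Joins f a b) :
    G.extendDist d l b ≤ G.extendDist d l a + l f := by
  obtain ⟨e, m⟩ := f
  have hnode := extendDist_subNode hd e m.2.le
  have hnext := extendDist_subNode hd e (Nat.succ_le_of_lt m.2)
  rcases h with ⟨rfl, rfl⟩ | ⟨rfl, rfl⟩
  · exact (hnext.trans_le (subNodeDist_succ_le e m)).trans_eq (by rw [← hnode]; rfl)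
  · exact (hnode.trans_le (subNodeDist_le_succ e m)).trans_eq (by rw [← hnext]; rfl)

end ExtendDist

theorem pathDist_le_pathDist_subdivide {l : E × Fin (r + 1) → ℝ} (hl : ∀ f, 0 ≤ l f) (u v : V) :
    G.pathDist (fun e => ∑ j, l (e, j)) u v ≤
      (G.subdivide r).pathDist l (Sum.inl u) (Sum.inl v) := by
  set d := G.pathDist (fun e => ∑ j, l (e, j)) u
  have hd : ∀ e a b, G.Joins e a b → d b ≤ d a + ∑ j, ENNReal.ofReal (l (e, j)) := fun e a b h => by
    rw [← ENNReal.ofReal_sum_of_nonneg fun j _ => hl (e, j)]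
    exact (pathDist_triangle (fun e => Finset.sum_nonneg fun j _ => hl (e, j)) u a b).trans
      (by gcongr; exact pathDist_le_of_joins _ h)
  have hle := le_add_pathDist hl (f := G.extendDist d fun f => ENNReal.ofReal (l f))
    (fun f a b h => extendDist_le_add hd h) (Sum.inl u) (Sum.inl v)
  have hu : d u = 0 := pathDist_self _ u
  simpa [extendDist, hu] using hle

end MultiGraph

namespace MulticutInstance

variable {V E : Type*} [Fintype E] {r k : ℕ} {I : MulticutInstance V E r} {x : E → ℝ}
  {y : Fin r → E → ℝ}

theorem opt_subdivide : (I.subdivide x y).opt = ∑ e, x e := by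
  simp [RoundingData.opt, subdivide, Fintype.sum_prod_type]

theorem sum_y_subdivide (i : Fin r) : ∑ f, (I.subdivide x y).y i f = ∑ e, y i e := by
  simp [subdivide, Fintype.sum_prod_type]

theorem sum_length_subdivide (i : Fin r) (e : E) :
    ∑ j, ((I.subdivide x y).x (e, j) + (I.subdivide x y).y i (e, j)) = x e + y i e := by
  simp [subdivide, Finset.sum_add_distrib]

namespace LPFeasible

theorem x_subdivide_nonneg (h : I.LPFeasible k x y) (f : E × Fin (r + 1)) :
    0 ≤ (I.subdivide x y).x f := by
  simp only [subdivide]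
  split_ifs <;> simp [h.2.2.1]

theorem y_subdivide_nonneg (h : I.LPFeasible k x y) (i : Fin r) (f : E × Fin (r + 1)) :
    0 ≤ (I.subdivide x y).y i f := by
  simp only [subdivide]
  split_ifs <;> simp [h.2.2.2]

theorem one_le_dist (h : I.LPFeasible k x y) (i : Fin r) :
    1 ≤ (I.subdivide x y).dist i (Sum.inl (I.s i)) (Sum.inl (I.t i)) := by
  refine le_trans ?_ (MultiGraph.pathDist_le_pathDist_subdivide
    (fun f => add_nonneg (h.x_subdivide_nonneg f) (h.y_subdivide_nonneg i f)) _ _)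
  simp only [sum_length_subdivide]
  exact MultiGraph.le_pathDist (fun e => add_nonneg (h.2.2.1 e) (h.2.2.2 i e)) fun p hp =>
    ENNReal.one_le_ofReal.2 (h.1 i p hp)

theorem admissible (h : I.LPFeasible k x y) : (I.subdivide x y).Admissible where
  x_nonneg := h.x_subdivide_nonneg
  y_nonneg := h.y_subdivide_nonneg
  x_eq_zero f hf := by
    have hf0 : f.2 ≠ 0 := by simpa [subdivide] using hf
    simp [subdivide, hf0]
  y_eq_zero i f hf := by
    have hf0 : f.2 = 0 := by simpa [subdivide] using hf
    simp [subdivide, hf0, (Fin.succ_ne_zero i).symm]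
  one_le_dist := h.one_le_dist

end LPFeasible

end MulticutInstance

/-! ### The approximation factor -/

section LogFactor

open Real

theorem one_lt_log_of_three_le {a : ℝ} (ha : 3 ≤ a) : 1 < log a :=
  (lt_log_iff_exp_lt (by linarith)).2 (exp_one_lt_three.trans_le ha)

theorem log_add_one_le_two_mul {a : ℝ} (ha : 2 ≤ a) : log (a + 1) ≤ 2 * log a :=
  calc log (a + 1) ≤ log (a ^ 2) := log_le_log (by linarith) (by nlinarith)
    _ = 2 * log a := by simp

theorem natLog_two_mul_le {r : ℕ} (hr : 2 ≤ r) : Nat.log 2 (2 * r) ≤ 4 * log r := by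
  have hr2 : (2 : ℝ) ≤ r := mod_cast hr
  have hlogr : 0 ≤ log (r : ℝ) := log_nonneg (by linarith)
  calc (Nat.log 2 (2 * r) : ℝ) ≤ logb 2 (2 * r) := mod_cast natLog_le_logb (2 * r) 2
    _ = (log 2 + log r) / log 2 := by rw [logb, log_mul two_ne_zero (by linarith)]
    _ ≤ 4 * log r := by
        rw [div_le_iff₀ (log_pos one_lt_two)]
        nlinarith [log_le_log two_pos hr2, log_two_gt_d9]

theorem log_log_exp_mul_succ_le {a : ℝ} (ha : 3 ≤ a) :
    log (log (exp 1 * (a + 1))) ≤ (log 3 / log (log 3) + 1) * log (log a) := by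
  have hlog := one_lt_log_of_three_le ha
  have hloglog3 : 0 < log (log 3) := log_pos (one_lt_log_of_three_le le_rfl)
  have hmono : log (log 3) ≤ log (log a) :=
    log_le_log (by linarith [one_lt_log_of_three_le le_rfl]) (log_le_log three_pos ha)
  calc log (log (exp 1 * (a + 1)))
      = log (1 + log (a + 1)) := by rw [log_mul (exp_ne_zero 1) (by linarith), log_exp]
    _ ≤ log (3 * log a) := by
        refine log_le_log ?_ (by linarith [log_add_one_le_two_mul (by linarith : 2 ≤ a)])
        linarith [log_nonneg (by linarith : 1 ≤ a + 1)]
    _ = log 3 / log (log 3) * log (log 3) + log (log a) := by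
        rw [div_mul_cancel₀ _ hloglog3.ne', log_mul three_ne_zero (by linarith)]
    _ ≤ log 3 / log (log 3) * log (log a) + log (log a) := by
        gcongr
    _ = (log 3 / log (log 3) + 1) * log (log a) := by ring

/-- The dependence on `r` of the cost of the algorithm, before it is compared with `logFactor`. -/
noncomputable def costFactor (r : ℕ) : ℝ :=
  log (log (exp 1 * (r + 1))) * (Nat.log 2 (2 * r) + log (r + 1) + log (exp 1 * (r + 1)))

theorem costFactor_nonneg {r : ℕ} (hr : 0 < r) : 0 ≤ costFactor r := by
  have hloglog := RoundingData.log_log_exp_mul_succ_pos ⟨0, hr⟩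
  have hlog : 0 ≤ log (r + 1 : ℝ) := log_nonneg (by simp)
  have hlog' := log_exp_mul_succ_nonneg r
  unfold costFactor
  positivity

theorem costFactor_le {r : ℕ} (hr : 3 ≤ r) :
    costFactor r ≤ 9 * (log 3 / log (log 3) + 1) * (log r * log (log r)) := by
  have hr3 : (3 : ℝ) ≤ r := mod_cast hr
  have hlog := one_lt_log_of_three_le hr3
  have hsucc := log_add_one_le_two_mul (by linarith : (2 : ℝ) ≤ r)
  have hsum : Nat.log 2 (2 * r) + log (r + 1) + log (exp 1 * (r + 1)) ≤ 9 * log r := by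
    rw [log_mul (exp_ne_zero 1) (by positivity), log_exp]
    linarith [natLog_two_mul_le (by omega : 2 ≤ r)]
  calc costFactor r ≤ log (log (exp 1 * (r + 1))) * (9 * log r) := by
        unfold costFactor
        gcongr
        exact (RoundingData.log_log_exp_mul_succ_pos ⟨0, by omega⟩).le
    _ ≤ (log 3 / log (log 3) + 1) * log (log r) * (9 * log r) := by
        gcongr
        exact log_log_exp_mul_succ_le hr3
    _ = 9 * (log 3 / log (log 3) + 1) * (log r * log (log r)) := by ring

theorem logFactor_nonneg (r : ℕ) : 0 ≤ logFactor r := by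
  unfold logFactor
  split_ifs with hr
  · exact zero_le_one
  · have hlog : 1 < log (r : ℝ) := one_lt_log_of_three_le (mod_cast (by omega : 3 ≤ r))
    exact mul_nonneg (by linarith) (log_pos hlog).le

theorem exists_costFactor_le_mul_logFactor :
    ∃ C : ℝ, 0 < C ∧ ∀ r : ℕ, 0 < r → costFactor r ≤ C * logFactor r := by
  set c := 9 * (log 3 / log (log 3) + 1)
  have hc : 0 < c := by
    have hlog := one_lt_log_of_three_le le_rfl
    have hloglog := log_pos hlog
    positivity
  have h1 := costFactor_nonneg one_pos
  have h2 := costFactor_nonneg two_pos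
  refine ⟨costFactor 1 + costFactor 2 + c, by positivity, fun r hr => ?_⟩
  rcases le_or_gt r 2 with hr2 | hr3
  · rw [logFactor, if_pos hr2, mul_one]
    obtain rfl | rfl : r = 1 ∨ r = 2 := by omega
    all_goals linarith
  · calc costFactor r ≤ c * logFactor r := by
          rw [logFactor, if_neg hr3.not_ge]
          exact costFactor_le hr3
      _ ≤ (costFactor 1 + costFactor 2 + c) * logFactor r := by
          have hL := logFactor_nonneg r
          gcongr
          linarith

end LogFactor

theorem div_sqrt_sub_one_sq_le {γ : ℝ} (hγ : 1 < γ) (hγ2 : γ ≤ 2) :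
    γ / (√γ - 1) ^ 2 ≤ 18 / (γ - 1) ^ 2 := by
  have hsqrt : 1 < √γ := Real.lt_sqrt_of_sq_lt (by simpa using hγ)
  have hsq : √γ ^ 2 = γ := Real.sq_sqrt (by linarith)
  have hle : γ - 1 ≤ 3 * (√γ - 1) := by nlinarith
  have hpos : 0 < √γ - 1 := by linarith
  calc γ / (√γ - 1) ^ 2 = 9 * γ / (3 * (√γ - 1)) ^ 2 := by field_simp; norm_num
    _ ≤ 9 * γ / (γ - 1) ^ 2 := by gcongr
    _ ≤ 18 / (γ - 1) ^ 2 := by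
        gcongr
        linarith

theorem div_sqrt_sub_one_sq_le_of_eq_div {γ κ : ℝ} (hκ : 2 ≤ κ) (hγ : γ = κ / (κ - 1)) :
    γ / (√γ - 1) ^ 2 ≤ 18 * (κ - 1) ^ 2 := by
  have hκ1 : 0 < κ - 1 := by linarith
  have hγ1 : γ - 1 = (κ - 1)⁻¹ := by
    rw [hγ]
    field_simp
    ring
  have hinv : 0 < (κ - 1)⁻¹ := inv_pos.2 hκ1
  have hinv1 : (κ - 1)⁻¹ ≤ 1 := inv_le_one_of_one_le₀ (by linarith)
  refine (div_sqrt_sub_one_sq_le (by linarith) (by linarith)).trans_eq ?_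
  rw [hγ1, inv_pow, div_inv_eq_mul]

theorem RoundingData.Admissible.costBound_le {V E : Type*} [Fintype E] {r : ℕ}
    {D : RoundingData V E r} (hD : D.Admissible) (hr : 0 < r) (S : Finset V) (N : ℕ) :
    D.costBound S N r ≤
      D.opt * (Nat.log 2 (2 * N) + Real.log (r + 1) + Real.log (Real.exp 1 * (r + 1))) := by
  have hr0 : (0 : ℝ) < r := mod_cast hr
  have hβ : D.β * r = D.opt := div_mul_cancel₀ _ hr0.ne'
  have hlog : Real.log (D.xVolume S / D.β) ≤ Real.log (r + 1) := by
    rcases hD.β_nonneg.eq_or_lt with h0 | h0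
    · rw [← h0, div_zero, Real.log_zero]
      exact Real.log_nonneg (by linarith)
    · have hX : 0 < D.xVolume S := by linarith [D.xVolume_eq S, hD.weight_nonneg S]
      exact Real.log_le_log (by positivity) ((div_le_iff₀ h0).2 (hD.xVolume_le hr S))
  calc D.costBound S N r
      ≤ D.opt * (Nat.log 2 (2 * N) + Real.log (r + 1)) +
        D.opt * Real.log (Real.exp 1 * (r + 1)) := by
        rw [costBound, hβ]
        have hlog0 := hD.log_xVolume_div_nonneg S
        have hopt := hD.opt_nonneg
        gcongr
        exact hD.weight_le_opt S
    _ = _ := (mul_add _ _ _).symm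

namespace MulticutInstance

variable {V E : Type*} {r k : ℕ} {I : MulticutInstance V E r} {Z : Finset E}

theorem isFeasible_iff_not_atLeastConnected :
    I.IsFeasible k Z ↔ ∀ i, ¬ I.graph.AtLeastConnected {e | e ∉ Z} (I.s i) (I.t i) k := by
  simp only [IsFeasible, MultiGraph.AtLeastConnected, Nat.cast_le, not_exists, not_and]
  exact forall₂_congr fun i m => by rw [← not_le]; tauto

variable [Fintype E] {x : E → ℝ} {y : Fin r → E → ℝ} {γ : ℝ}
  {χ : Choices (V ⊕ (E × Fin r)) r}

namespace LPFeasible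

theorem exists_validChoices (h : I.LPFeasible k x y) (hr : 0 < r) (hk : 1 < k) (hγ : 1 < γ) :
    ∃ χ, (I.subdivide x y).ValidChoices γ k χ :=
  h.admissible.exists_validChoices (fun i => (sum_y_subdivide i).trans_le (h.2.1 i)) hr hk hγ

variable [Fintype V]

theorem exists_algReturns (h : I.LPFeasible k x y) (hχ : (I.subdivide x y).ValidChoices γ k χ) :
    ∃ Z, I.AlgReturns k γ x y χ Z := by
  classical
  obtain ⟨Z', hZ'⟩ := h.admissible.exists_returns hχ Finset.univ Finset.univ
  exact ⟨_, Z', hZ', rfl⟩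

theorem card_le (h : I.LPFeasible k x y) (hr : 0 < r) (hγ : 0 ≤ γ)
    (hχ : (I.subdivide x y).ValidChoices γ k χ) (hZ : I.AlgReturns k γ x y χ Z) :
    (Z.card : ℝ) ≤ 2 * (γ / (√γ - 1) ^ 2) * costFactor r * ∑ e, x e := by
  classical
  obtain ⟨Z', hreturns, rfl⟩ := hZ
  have hcost := h.admissible.returns_cost_le hγ hr hχ hreturns
  rw [Finset.card_univ, Fintype.card_fin] at hcost
  have himage : (Z'.image Prod.fst).card ≤ Z'.card := Finset.card_image_le
  calc _ ≤ (Z'.card : ℝ) := by convert Nat.cast_le (α := ℝ).2 himage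
    _ ≤ RoundingData.cutFactor γ r * (I.subdivide x y).costBound Finset.univ r r := hcost
    _ ≤ RoundingData.cutFactor γ r * ((I.subdivide x y).opt *
        (Nat.log 2 (2 * r) + Real.log (r + 1) + Real.log (Real.exp 1 * (r + 1)))) := by
        gcongr
        · exact RoundingData.cutFactor_nonneg hγ hr
        · exact h.admissible.costBound_le hr _ _
    _ = 2 * (γ / (√γ - 1) ^ 2) * costFactor r * ∑ e, x e := by
        rw [opt_subdivide, RoundingData.cutFactor, costFactor]
        ring

end LPFeasible

theorem AlgReturns.not_atLeastConnected [Fintype V] (hZ : I.AlgReturns k γ x y χ Z)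
    (hq : 0 < γ * ((k : ℝ) - 1)) (i : Fin r) :
    ¬ I.graph.AtLeastConnected {e | e ∉ Z} (I.s i) (I.t i) (γ * ((k : ℝ) - 1)) := by
  classical
  rintro ⟨m, hm, hpaths⟩
  obtain ⟨Z', hreturns, rfl⟩ := hZ
  refine RoundingData.not_hasDisjointPaths_of_returns hreturns (Q := {f | f ∉ Z'})
    (fun f hf => hf) (Finset.mem_univ i) (Finset.mem_univ _) (mod_cast hq.trans_le hm) hm ?_
  obtain ⟨P, hP, hdisj⟩ := hpaths.subdivide (r := r)
  refine ⟨P, fun j => ⟨(hP j).1, fun f hf => ⟨⟨Finset.mem_univ _, Finset.mem_univ _⟩,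
    fun hfZ => ?_⟩⟩, hdisj⟩
  exact (hP j).2 f hf (by convert Finset.mem_image_of_mem Prod.fst hfZ)

end MulticutInstance

theorem theorem3p7_general :
    ∃ C : ℝ, 0 < C ∧
      ∀ (V E : Type*) [Fintype V] [Fintype E] (r k : ℕ) (I : MulticutInstance V E r)
        (x : E → ℝ) (y : Fin r → E → ℝ), 1 ≤ r → 2 ≤ k → I.LPFeasible k x y →
        (∀ γ : ℝ, 1 < γ →
          (∃ χ, (I.subdivide x y).ValidChoices γ k χ) ∧
          ∀ χ, (I.subdivide x y).ValidChoices γ k χ →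
            (∃ Z, I.AlgReturns k γ x y χ Z) ∧
            ∀ Z, I.AlgReturns k γ x y χ Z →
              (∀ i, ¬ I.graph.AtLeastConnected {e | e ∉ Z} (I.s i) (I.t i) (γ * ((k : ℝ) - 1))) ∧
              (Z.card : ℝ) ≤ C * (γ / (√γ - 1) ^ 2 * logFactor r) * ∑ e, x e) ∧
        (∀ χ, (I.subdivide x y).ValidChoices ((k : ℝ) / ((k : ℝ) - 1)) k χ →
          ∀ Z, I.AlgReturns k ((k : ℝ) / ((k : ℝ) - 1)) x y χ Z →
            I.IsFeasible k Z ∧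
            (Z.card : ℝ) ≤ C * (((k : ℝ) - 1) ^ 2 * logFactor r) * ∑ e, x e) := by
  obtain ⟨C, hC, hlog⟩ := exists_costFactor_le_mul_logFactor
  refine ⟨36 * C, by positivity, fun V E _ _ r k I x y hr hk h => ?_⟩
  have hk2 : (2 : ℝ) ≤ k := mod_cast hk
  have hk1 : 0 < (k : ℝ) - 1 := by linarith
  have hx : 0 ≤ ∑ e, x e := Finset.sum_nonneg fun e _ => h.2.2.1 e
  have hcard {γ M : ℝ} (hγ : 0 ≤ γ) (hM : γ / (√γ - 1) ^ 2 ≤ 18 * M) {χ Z}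
      (hχ : (I.subdivide x y).ValidChoices γ k χ) (hZ : I.AlgReturns k γ x y χ Z) :
      (Z.card : ℝ) ≤ 36 * C * (M * logFactor r) * ∑ e, x e :=
    calc (Z.card : ℝ) ≤ 2 * (γ / (√γ - 1) ^ 2) * costFactor r * ∑ e, x e := h.card_le hr hγ hχ hZ
      _ ≤ 2 * (18 * M) * (C * logFactor r) * ∑ e, x e := by
          have hM0 : 0 ≤ γ / (√γ - 1) ^ 2 := by positivity
          gcongr
          exacts [costFactor_nonneg hr, by linarith, hlog r hr]
      _ = 36 * C * (M * logFactor r) * ∑ e, x e := by ring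
  refine ⟨fun γ hγ => ⟨h.exists_validChoices hr hk hγ, fun χ hχ => ⟨h.exists_algReturns hχ,
    fun Z hZ => ⟨hZ.not_atLeastConnected (by positivity), ?_⟩⟩⟩, fun χ hχ Z hZ => ⟨?_, ?_⟩⟩
  · have hγ0 : 0 ≤ γ / (√γ - 1) ^ 2 := by positivity
    exact hcard (by linarith) (by linarith) hχ hZ
  · rw [MulticutInstance.isFeasible_iff_not_atLeastConnected, ← div_mul_cancel₀ (k : ℝ) hk1.ne']
    exact hZ.not_atLeastConnected (by positivity)
  · exact hcard (by positivity) (div_sqrt_sub_one_sq_le_of_eq_div hk2 rfl) hχ hZ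

theorem theorem3p7 :
    ∃ C : ℝ, 0 < C ∧
      ∀ (V E : Type*) [Fintype V] [Fintype E] (r k : ℕ) (I : MulticutInstance V E r)
        (x : E → ℝ) (y : Fin r → E → ℝ), 1 ≤ r → 2 ≤ k → I.LPOptimal k x y →
        (∀ γ : ℝ, 1 < γ →
          (∃ χ, (I.subdivide x y).ValidChoices γ k χ) ∧
          ∀ χ, (I.subdivide x y).ValidChoices γ k χ →
            (∃ Z, I.AlgReturns k γ x y χ Z) ∧
            ∀ Z, I.AlgReturns k γ x y χ Z →
              (∀ i, ¬ I.graph.AtLeastConnected {e | e ∉ Z} (I.s i) (I.t i) (γ * ((k : ℝ) - 1))) ∧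
              (Z.card : ℝ) ≤ C * (γ / (√γ - 1) ^ 2 * logFactor r) * ∑ e, x e) ∧
        (∀ χ, (I.subdivide x y).ValidChoices ((k : ℝ) / ((k : ℝ) - 1)) k χ →
          ∀ Z, I.AlgReturns k ((k : ℝ) / ((k : ℝ) - 1)) x y χ Z →
            I.IsFeasible k Z ∧
            (Z.card : ℝ) ≤ C * (((k : ℝ) - 1) ^ 2 * logFactor r) * ∑ e, x e) := by
  obtain ⟨C, hC, h⟩ := theorem3p7_general
  exact ⟨C, hC, fun V E _ _ r k I x y hr hk hopt => h V E r k I x y hr hk hopt.1⟩
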